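/- Let $u_1,u_2,\dots$ be a stationary sequence of random variables with mean zero and common variance in $(0,\infty)$ such that (A) the process $N^{-1/2}\sum_{i=1}^{\lfloor Nr\rfloor}u_i$, $r\in[0,1]$, converges weakly in $D[0,1]$ (with the Skorokhod topology) to $\sigma B(r)$, where $B$ is a standard Brownian motion, $0<\sigma<\infty$ and $\sigma^2=\lim_{N\to\infty}E\bigl(N^{-1/2}\sum_{i=1}^N u_i\bigr)^2$. Let $(h_N)$ be positive constants with $N/h_N\to\zeta\in[1,\infty)$, and let the kernel and the drift function satisfy: (K) $K:\mathbb R\to[0,\infty)$ is a Lipschitz continuous probability density with mean $0$ and finite variance. (M) $m_0:\mathbb R\to\mathbb R$ is piecewise continuous (finitely many discontinuities in every compact interval, with finite one-sided limits everywhere), $m_0(t)=0$ for $t\le 0$ and $m_0(t)\ge 0$ for $t>0$. (KM) The function $I(x)=\int_0^x K(s-x)\int_0^s m_0(r)\,dr\,ds$ is finite and continuous on $[0,\infty)$, the function $x\mapsto K(x)\int_0^x m_0(r)\,dr$ has bounded variation, and $I(x^*)>c$ for some $x^*>0$, where $c\in\mathbb R$ is a given threshold. Let the change-point be either $t_q=q$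 for a fixed integer $q\ge 0$ (model CP1; put $1_{CP2}=0$) or $t_q=\lfloor N\vartheta\rfloor$ for some $\vartheta\in(0,1)$ (model CP2; put $1_{CP2}=1$). For $\beta\in\mathbb R$ let $Y_{N,1}=Y_1$ be an arbitrary random variable not depending on $N$, and let $$Y_{N,n+1}=Y_{N,n}+m_0\Bigl(\frac{n-t_q}{h_N}\Bigr)h_N^{\beta}+u_n,\qquad 1\le n\le N .$$ Put $h=h_N$, $K_h(z)=h^{-1}K(z/h)$ and $$\widehat m_N(s)=\frac{\sum_{i=1}^{\lfloor Ns\rfloor}K_h(i-\lfloor Ns\rfloor)\,Y_{N,i}}{\sum_{i=1}^{\lfloor Ns\rfloor}K_h(i-\lfloor Ns\rfloor)} .$$ Fix $0<a<1$ and suppose that $\int_0^sK(\zeta(r-s))\,dr\ne 0$ for all $s\in[a,1]$. Define $$\delta(s)=\frac{\int_0^s K(\zeta(r-s))\int_0^{\zeta r}m_0(t-\zeta\vartheta 1_{CP2})\,dt\,dr}{\zeta^{3/2}\int_0^sK(\zeta(r-s))\,dr},\qquad s\in[a,1].$$ (i) If $\beta=-1/2$, then, weakly in $D[a,1]$ as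 $N\to\infty$, $$\frac{h}{N^{3/2}}\,\widehat m_N(s)\;\Rightarrow\;\sigma\,\frac{\int_0^sK(\zeta(r-s))B(r)\,dr}{\zeta\int_0^sK(\zeta(r-s))\,dr}+\delta(s).$$ (ii) If $\beta=0$, then $\frac{h^{1/2}}{N^{3/2}}\,\widehat m_N(s)$ converges in probability to $\delta(s)$, uniformly in $s\in[a,1]$; that is, for every $\varepsilon>0$, $$P\Bigl(\sup_{s\in[a,1]}\Bigl|\frac{h^{1/2}}{N^{3/2}}\,\widehat m_N(s)-\delta(s)\Bigr|\ge\varepsilon\Bigr)\to 0\qquad (N\to\infty).$$ -/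

import Mathlib

open MeasureTheory ProbabilityTheory Filter Topology Set
open scoped NNReal ENNReal

/-! ### The Skorokhod space `D[a,b]` and weak convergence of processes in it -/

/-- A function on `[a,b]` is càdlàg if it is right-continuous and has (finite) left-hand limits. -/
def IsCadlag {a b : ℝ} (f : Icc a b → ℝ) : Prop :=
  ∀ t, ContinuousWithinAt f (Ici t) t ∧ ∃ l : ℝ, Tendsto f (𝓝[<] t) (𝓝 l)

/-- The Skorokhod space `D[a,b]`, the set of càdlàg functions on `[a,b]`. -/
def SkorokhodSpace (a b : ℝ) : Type := {f : Icc a b → ℝ // IsCadlag f}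

namespace SkorokhodSpace

variable {a b : ℝ}

instance : CoeFun (SkorokhodSpace a b) (fun _ => Icc a b → ℝ) := ⟨fun f => f.1⟩

/-- The cost of matching `f` with `g` through the time change `τ` (an increasing bijection of
`[a,b]`): `max (sup |τ t - t|) (sup |f t - g (τ t)|)`. -/
noncomputable def cost (τ : Icc a b ≃o Icc a b) (f g : SkorokhodSpace a b) : ℝ≥0∞ :=
  (⨆ t, edist (τ t) t) ⊔ ⨆ t, edist (f t) (g (τ t))

theorem cost_refl (f : SkorokhodSpace a b) : cost (OrderIso.refl _) f f = 0 := by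
  simp [cost]

theorem cost_symm (τ : Icc a b ≃o Icc a b) (f g : SkorokhodSpace a b) :
    cost τ.symm g f ≤ cost τ f g := by
  refine sup_le_sup (iSup_le fun t => ?_) (iSup_le fun t => ?_)
  · refine le_trans (le_of_eq ?_) (le_iSup (fun t => edist (τ t) t) (τ.symm t))
    simp [edist_comm]
  · refine le_trans (le_of_eq ?_) (le_iSup (fun t => edist (f t) (g (τ t))) (τ.symm t))
    simp [edist_comm]

theorem cost_trans (τ ρ : Icc a b ≃o Icc a b) (f g k : SkorokhodSpace a b) :
    cost (τ.trans ρ) f k ≤ cost τ f g + cost ρ g k := by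
  refine sup_le (iSup_le fun t => ?_) (iSup_le fun t => ?_)
  · have h1 : edist (τ t) t ≤ cost τ f g :=
      (le_iSup (fun t => edist (τ t) t) t).trans le_sup_left
    have h2 : edist (ρ (τ t)) (τ t) ≤ cost ρ g k :=
      (le_iSup (fun t => edist (ρ t) t) (τ t)).trans le_sup_left
    calc edist (ρ (τ t)) t ≤ edist (ρ (τ t)) (τ t) + edist (τ t) t := edist_triangle _ _ _
      _ ≤ cost ρ g k + cost τ f g := add_le_add h2 h1
      _ = _ := add_comm _ _
  · have h1 : edist (f t) (g (τ t)) ≤ cost τ f g :=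
      (le_iSup (fun t => edist (f t) (g (τ t))) t).trans le_sup_right
    have h2 : edist (g (τ t)) (k (ρ (τ t))) ≤ cost ρ g k :=
      (le_iSup (fun t => edist (g t) (k (ρ t))) (τ t)).trans le_sup_right
    exact (edist_triangle _ _ _).trans (add_le_add h1 h2)

/-- The Skorokhod distance `d(f,g) = inf_τ max (sup |τ t - t|) (sup |f t - g (τ t)|)`, which
induces the Skorokhod topology. -/
noncomputable instance : PseudoEMetricSpace (SkorokhodSpace a b) where
  edist f g := ⨅ τ : Icc a b ≃o Icc a b, cost τ f g
  edist_self f := le_antisymm ((iInf_le _ (OrderIso.refl _)).trans (cost_refl f).le) bot_le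
  edist_comm f g := le_antisymm
    (le_iInf fun τ => (iInf_le _ τ.symm).trans (cost_symm τ g f))
    (le_iInf fun τ => (iInf_le _ τ.symm).trans (cost_symm τ f g))
  edist_triangle f g k := ENNReal.le_iInf_add_iInf fun τ ρ =>
    (iInf_le _ (τ.trans ρ)).trans (cost_trans τ ρ f g k)

noncomputable instance : MeasurableSpace (SkorokhodSpace a b) := borel _

instance : BorelSpace (SkorokhodSpace a b) := ⟨rfl⟩

end SkorokhodSpace

/-- Weak convergence in `D[a,b]` of the processes `X N` (on `(Ω, P)`) to the process `Z`
(on `(Ω', P')`), as `N → ∞`: almost all paths of these processes, restricted to `[a,b]`, are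
elements of `D[a,b]`, the resulting maps into `D[a,b]` are random elements for the Borel
`σ`-algebra of the Skorokhod topology, and their laws converge weakly. -/
def WeaklyConvergesInD {Ω Ω' : Type*} [MeasurableSpace Ω] [MeasurableSpace Ω'] (a b : ℝ)
    (X : ℕ → ℝ → Ω → ℝ) (P : Measure Ω) [IsProbabilityMeasure P]
    (Z : ℝ → Ω' → ℝ) (P' : Measure Ω') [IsProbabilityMeasure P'] : Prop :=
  ∃ (X' : ℕ → Ω → SkorokhodSpace a b) (Z' : Ω' → SkorokhodSpace a b),
    (∀ N, ∀ᵐ ω ∂P, ∀ t : Icc a b, X' N ω t = X N t ω) ∧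
    (∀ᵐ ω ∂P', ∀ t : Icc a b, Z' ω t = Z t ω) ∧
    TendstoInDistribution X' atTop Z' (fun _ => P) P'

/-- Convergence in probability of the processes `X N` to the deterministic function `f`,
uniformly on the set `S` of time points. -/
def UniformlyConvergesInProbability {Ω : Type*} [MeasurableSpace Ω] (S : Set ℝ)
    (X : ℕ → ℝ → Ω → ℝ) (P : Measure Ω) (f : ℝ → ℝ) : Prop :=
  ∀ ε : ℝ, 0 < ε → Tendsto (fun N => P {ω | ∃ s ∈ S, ε ≤ |X N s ω - f s|}) atTop (𝓝 0)

/-! ### Assumptions -/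

/-- Assumption (A) on the innovations `u 1, u 2, …`: a (second-order) stationary sequence with
mean zero and positive finite variance, such that the partial sum process
`N^{-1/2} ∑_{i ≤ ⌊N r⌋} u i`, `r ∈ [0,1]`, converges weakly in `D[0,1]` to `σ B(r)`, where
`σ² = lim_N E (N^{-1/2} ∑_{i ≤ N} u i)²` and `0 < σ`. -/
structure AssumptionA {Ω Ω' : Type*} [MeasurableSpace Ω] [MeasurableSpace Ω']
    (P : Measure Ω) [IsProbabilityMeasure P] (P' : Measure Ω') [IsProbabilityMeasure P']
    (u : ℕ → Ω → ℝ) (σ : ℝ) (B : ℝ≥0 → Ω' → ℝ) : Prop where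
  memLp : ∀ n, 1 ≤ n → MemLp (u n) 2 P
  mean_zero : ∀ n, 1 ≤ n → ∫ ω, u n ω ∂P = 0
  variance_pos : ∀ n, 1 ≤ n → 0 < variance (u n) P
  stationary : ∀ m n k, 1 ≤ m → 1 ≤ n →
    covariance (u m) (u (m + k)) P = covariance (u n) (u (n + k)) P
  sigma_pos : 0 < σ
  longRunVariance : Tendsto
    (fun N : ℕ => ∫ ω, ((√(N : ℝ))⁻¹ * ∑ i ∈ Finset.Icc 1 N, u i ω) ^ 2 ∂P) atTop (𝓝 (σ ^ 2))
  functionalCLT : WeaklyConvergesInD 0 1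
    (fun (N : ℕ) r ω => (√(N : ℝ))⁻¹ * ∑ i ∈ Finset.Icc 1 ⌊(N : ℝ) * r⌋₊, u i ω) P
    (fun r ω => σ * B r.toNNReal ω) P'

/-- Assumption (K): the kernel is a Lipschitz continuous probability density with mean `0` and
finite variance. -/
structure AssumptionK (K : ℝ → ℝ) : Prop where
  lipschitz : ∃ L : ℝ, ∀ z₁ z₂, |K z₁ - K z₂| ≤ L * |z₁ - z₂|
  nonneg : ∀ z, 0 ≤ K z
  integrable : Integrable K
  integral_eq_one : ∫ z, K z = 1
  integrable_mul : Integrable fun z => z * K z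
  mean_zero : ∫ z, z * K z = 0
  integrable_sq_mul : Integrable fun z => z ^ 2 * K z

/-- `f` is piecewise continuous: every compact interval contains only finitely many
discontinuities, and finite one-sided limits exist at every point. -/
def PiecewiseContinuous (f : ℝ → ℝ) : Prop :=
  (∀ x y, (Icc x y ∩ {t | ¬ ContinuousAt f t}).Finite) ∧
    ∀ t, (∃ l : ℝ, Tendsto f (𝓝[<] t) (𝓝 l)) ∧ ∃ r : ℝ, Tendsto f (𝓝[>] t) (𝓝 r)

/-- The generic alternative `m₀` vanishes on `(-∞, 0]`, is nonnegative on `(0, ∞)`, and satisfies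
(M), i.e. is piecewise continuous. -/
structure IsGenericAlternative (m₀ : ℝ → ℝ) : Prop where
  eq_zero : ∀ t, t ≤ 0 → m₀ t = 0
  nonneg : ∀ t, 0 < t → 0 ≤ m₀ t
  piecewiseContinuous : PiecewiseContinuous m₀

/-- The function `I(x) = ∫_0^x K(s - x) ∫_0^s m₀(r) dr ds`. -/
noncomputable def driftFunctional (K m₀ : ℝ → ℝ) (x : ℝ) : ℝ :=
  ∫ s in 0..x, K (s - x) * ∫ r in 0..s, m₀ r

/-- Assumption (KM), `c` being the threshold of the monitoring procedure: `I` is well defined,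
finite and continuous on `[0, ∞)`, the function `x ↦ K(x) ∫_0^x m₀` has bounded variation, and
`I(x*) > c` for some `x* > 0`. -/
structure AssumptionKM (K m₀ : ℝ → ℝ) (c : ℝ) : Prop where
  integrable : ∀ x, 0 ≤ x →
    IntervalIntegrable (fun s => K (s - x) * ∫ r in 0..s, m₀ r) volume 0 x
  continuousOn : ContinuousOn (driftFunctional K m₀) (Ici 0)
  boundedVariation : BoundedVariationOn (fun x => K x * ∫ r in 0..x, m₀ r) univ
  exceeds : ∃ x, 0 < x ∧ c < driftFunctional K m₀ x

/-! ### The random walk with local drift and the sequential smoother -/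

/-- The two change-point models: CP1, a change-point at a fixed integer `q`, and CP2, a
change-point `⌊N ϑ⌋` after a fixed fraction `ϑ ∈ (0,1)` of the data. -/
inductive ChangePointModel where
  | CP1 (q : ℕ)
  | CP2 (ϑ : ℝ) (pos : 0 < ϑ) (lt_one : ϑ < 1)

/-- The change-point `t_q` for the maximum sample size `N`. -/
noncomputable def ChangePointModel.time : ChangePointModel → ℕ → ℕ
  | CP1 q, _ => q
  | CP2 ϑ _ _, N => ⌊(N : ℝ) * ϑ⌋₊

/-- The quantity `ϑ 1_{CP2}`. -/
def ChangePointModel.fraction : ChangePointModel → ℝ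
  | CP1 _ => 0
  | CP2 ϑ _ _ => ϑ

/-- The local drift `m_{N,n} = m₀((n - t_q) / h_N) h_N^β`. -/
noncomputable def localDrift (cp : ChangePointModel) (m₀ : ℝ → ℝ) (h : ℕ → ℝ) (β : ℝ)
    (N n : ℕ) : ℝ :=
  m₀ (((n : ℝ) - (cp.time N : ℝ)) / h N) * h N ^ β

/-- `Y` is a random walk with local drift, started at `Y₁`:
`Y_{N,1} = Y₁` and `Y_{N,n+1} = Y_{N,n} + m_{N,n} + u_n` for `1 ≤ n ≤ N`. -/
structure IsRandomWalkWithLocalDrift {Ω : Type*} (cp : ChangePointModel) (m₀ : ℝ → ℝ)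
    (h : ℕ → ℝ) (β : ℝ) (u : ℕ → Ω → ℝ) (Y₁ : Ω → ℝ) (Y : ℕ → ℕ → Ω → ℝ) : Prop where
  init : ∀ N ω, Y N 1 ω = Y₁ ω
  step : ∀ N n ω, 1 ≤ n → n ≤ N → Y N (n + 1) ω = Y N n ω + localDrift cp m₀ h β N n + u n ω

/-- The rescaled kernel `K_h(z) = h⁻¹ K(z / h)`. -/
noncomputable def rescaledKernel (K : ℝ → ℝ) (h z : ℝ) : ℝ := h⁻¹ * K (z / h)

/-- The sequential kernel smoother
`m̂_N(s) = ∑_{i=1}^{⌊Ns⌋} K_h(i - ⌊Ns⌋) Y_{N,i} / ∑_{i=1}^{⌊Ns⌋} K_h(i - ⌊Ns⌋)`, `h = h_N`. -/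
noncomputable def sequentialSmoother {Ω : Type*} (K : ℝ → ℝ) (h : ℕ → ℝ) (Y : ℕ → ℕ → Ω → ℝ)
    (N : ℕ) (s : ℝ) (ω : Ω) : ℝ :=
  (∑ i ∈ Finset.Icc 1 ⌊(N : ℝ) * s⌋₊,
      rescaledKernel K (h N) ((i : ℝ) - (⌊(N : ℝ) * s⌋₊ : ℝ)) * Y N i ω) /
    ∑ i ∈ Finset.Icc 1 ⌊(N : ℝ) * s⌋₊,
      rescaledKernel K (h N) ((i : ℝ) - (⌊(N : ℝ) * s⌋₊ : ℝ))

/-! ### The limits -/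

/-- The null limit `σ ∫_0^s K(ζ(r-s)) B(r) dr / (ζ ∫_0^s K(ζ(r-s)) dr)`. -/
noncomputable def nullLimit {Ω' : Type*} (K : ℝ → ℝ) (ζ σ : ℝ) (B : ℝ≥0 → Ω' → ℝ)
    (s : ℝ) (ω : Ω') : ℝ :=
  σ * (∫ r in 0..s, K (ζ * (r - s)) * B r.toNNReal ω) / (ζ * ∫ r in 0..s, K (ζ * (r - s)))

/-- The drift
`∫_0^s K(ζ(r-s)) ∫_0^{ζr} m₀(t - ζ ϑ 1_{CP2}) dt dr / (ζ^{3/2} ∫_0^s K(ζ(r-s)) dr)`. -/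
noncomputable def limitDrift (cp : ChangePointModel) (K m₀ : ℝ → ℝ) (ζ s : ℝ) : ℝ :=
  (∫ r in 0..s, K (ζ * (r - s)) * ∫ t in 0..(ζ * r), m₀ (t - ζ * cp.fraction)) /
    (ζ ^ (3 / 2 : ℝ) * ∫ r in 0..s, K (ζ * (r - s)))

/-! Only one input is random in the limit, the partial sum path `S_N` of the innovations; everything
else is a deterministic estimate along each path. The walk at index `⌊N r⌋ + 1` is `Y₁` plus a drift
sum plus `√N * S_N(r)`. Since `h_N` grows like `N / ζ`, the smoother is a ratio of Riemann sums with
kernel `K (ζ (r - s))` (`abs_weightedAverage_sub_le`), and the normalised drift sum is a Riemann sum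
for `∫_0^{ζ r} m₀(t - ζ ϑ 1_{CP2}) dt` (`exists_riemannSum_sub_integral_le`). Hence, uniformly in
`s`, the rescaled smoother differs from `b ∫K S_N / ∫K + δ` by at most `e_N (1 + sup |S_N| + |Y₁|)`
with `e_N → 0` deterministic (`exists_smoother_sub_le`).

The random factor is tight: superlevel sets of the sup norm are closed in the Skorokhod topology, so
the portmanteau theorem carries the tails of the limit over to `S_N`
(`tendsto_measure_mul_supENorm`). The error therefore vanishes in probability.

If `β = -1/2`, then `b = 1 / ζ`. The smoothing map `D[0,1] → D[a,1]` is continuous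
(`continuous_smooth`), since Skorokhod convergence implies `L¹` convergence and the kernel is
bounded on the relevant range; continuous mapping and Slutsky (`TendstoInDistribution.of_edist`)
finish (i). If `β = 0`, the scaling is smaller by `h^{1/2}`, so `b = 0`: the noise disappears and
the pathwise bound is already (ii). -/

/-! ### Càdlàg functions: boundedness, measurability, countably many jumps -/

theorem IsCompact.exists_abs_le_of_eventually {X : Type*} [TopologicalSpace X] {s : Set X}
    (hs : IsCompact s) {f : X → ℝ} (hf : ∀ x ∈ s, ∃ M, ∀ᶠ y in 𝓝 x, |f y| ≤ M) :
    ∃ M, ∀ x ∈ s, |f x| ≤ M := by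
  refine hs.induction_on (p := fun s => ∃ M, ∀ x ∈ s, |f x| ≤ M) ⟨0, by simp⟩ ?_ ?_ ?_
  · rintro s t hst ⟨M, hM⟩
    exact ⟨M, fun x hx => hM x (hst hx)⟩
  · rintro s t ⟨M, hM⟩ ⟨M', hM'⟩
    refine ⟨max M M', fun x hx => ?_⟩
    rcases hx with hx | hx
    · exact (hM x hx).trans (le_max_left _ _)
    · exact (hM' x hx).trans (le_max_right _ _)
  · intro x hx
    obtain ⟨M, hM⟩ := hf x hx
    exact ⟨_, mem_nhdsWithin_of_mem_nhds hM, M, fun y hy => hy⟩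

theorem Filter.Tendsto.eventually_abs_le {X : Type*} {l : Filter X} {f : X → ℝ} {c : ℝ}
    (hf : Tendsto f l (𝓝 c)) : ∀ᶠ x in l, |f x| ≤ |c| + 1 :=
  (hf.abs.eventually (eventually_lt_nhds (lt_add_one _))).mono fun _ hx => hx.le

namespace IsCadlag

variable {a b : ℝ} {f : Icc a b → ℝ}

theorem exists_abs_le (hf : IsCadlag f) : ∃ M, ∀ t, |f t| ≤ M := by
  obtain ⟨M, hM⟩ := isCompact_univ.exists_abs_le_of_eventually (f := f) fun t _ => by
    obtain ⟨hr, l, hl⟩ := hf t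
    refine ⟨max (|l| + 1) (|f t| + 1), ?_⟩
    rw [← nhdsLT_sup_nhdsGE t, eventually_sup]
    exact ⟨hl.eventually_abs_le.mono fun _ h => h.trans (le_max_left _ _),
      hr.tendsto.eventually_abs_le.mono fun _ h => h.trans (le_max_right _ _)⟩
  exact ⟨M, fun t => hM t trivial⟩

theorem of_continuous (hf : Continuous f) : IsCadlag f := fun t =>
  ⟨hf.continuousWithinAt, f t, hf.continuousWithinAt.tendsto⟩

/-- By right-continuity `f` is the pointwise limit of its values at the next grid point of mesh `1 /
(n + 1)` to the right, clamped to `[a,b]`. Each approximant factors through `ℤ`. -/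
theorem measurable (hf : IsCadlag f) : Measurable f := by
  rcases isEmpty_or_nonempty (Icc a b) with he | ⟨⟨t₀⟩⟩
  · exact measurable_of_empty f
  have hab : a ≤ b := t₀.2.1.trans t₀.2.2
  let p : ℕ → Icc a b → Icc a b := fun n t =>
    projIcc a b hab ((⌊((n : ℝ) + 1) * t⌋ + 1 : ℝ) / ((n : ℝ) + 1))
  have hlow : ∀ (n : ℕ) (t : ℝ), t ≤ (⌊((n : ℝ) + 1) * t⌋ + 1 : ℝ) / ((n : ℝ) + 1) := by
    intro n t
    rw [le_div_iff₀ (by positivity)]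
    linarith [Int.lt_floor_add_one (((n : ℝ) + 1) * t)]
  have hup : ∀ (n : ℕ) (t : ℝ), (⌊((n : ℝ) + 1) * t⌋ + 1 : ℝ) / ((n : ℝ) + 1) ≤
      t + 1 / ((n : ℝ) + 1) := by
    intro n t
    have h0 : (0 : ℝ) < (n : ℝ) + 1 := by positivity
    rw [div_le_iff₀ h0, add_mul _ _ ((n : ℝ) + 1), one_div, inv_mul_cancel₀ h0.ne']
    linarith [Int.floor_le (((n : ℝ) + 1) * t)]
  refine measurable_of_tendsto_metrizable (f := fun n t => f (p n t)) (fun n => ?_) ?_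
  · have : (fun t => f (p n t)) = (fun z : ℤ => f (projIcc a b hab ((z + 1 : ℝ) / ((n : ℝ) + 1)))) ∘
        fun t : Icc a b => ⌊((n : ℝ) + 1) * (t : ℝ)⌋ := rfl
    rw [this]
    exact measurable_from_top.comp
      (Int.measurable_floor.comp (measurable_subtype_coe.const_mul _))
  · rw [tendsto_pi_nhds]
    intro t
    refine (hf t).1.tendsto.comp (tendsto_nhdsWithin_iff.2 ⟨?_, Eventually.of_forall fun n => ?_⟩)
    · have h1 : Tendsto (fun n : ℕ => (⌊((n : ℝ) + 1) * (t : ℝ)⌋ + 1 : ℝ) / ((n : ℝ) + 1)) atTop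
          (𝓝 (t : ℝ)) := by
        refine tendsto_of_tendsto_of_tendsto_of_le_of_le tendsto_const_nhds ?_
          (fun n => hlow n t) (fun n => hup n t)
        simpa using tendsto_const_nhds.add (tendsto_one_div_add_atTop_nhds_zero_nat (𝕜 := ℝ))
      have := (continuous_projIcc (h := hab)).continuousAt.tendsto.comp h1
      rwa [projIcc_val] at this
    · change t ≤ p n t
      calc t = projIcc a b hab t := (projIcc_val hab t).symm
        _ ≤ p n t := monotone_projIcc hab (hlow n t)

/-- An upward jump at `t` yields rationals `q < t` and `p` with `f < p` on `(q, t)` and `p < f t`.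
The pair determines `t`: of two such points the smaller would have a value both below and above `p`.
Downward jumps are covered by passing to `-f`. -/
theorem countable_leftLim_lt (f : Icc a b → ℝ) :
    {t | (∃ s, s < t) ∧ ∃ l, Tendsto f (𝓝[<] t) (𝓝 l) ∧ l < f t}.Countable := by
  let E : ℚ × ℚ → Set (Icc a b) := fun q =>
    {t | (q.1 : ℝ) < t ∧ (∀ x : Icc a b, (q.1 : ℝ) < x → x < t → f x < q.2) ∧ (q.2 : ℝ) < f t}
  have hE : ∀ q, (E q).Countable := fun q => by
    refine Set.Subsingleton.countable fun t ht t' ht' => ?_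
    rcases lt_trichotomy t t' with h | h | h
    · exact absurd (ht'.2.1 t ht.1 h) ht.2.2.not_gt
    · exact h
    · exact absurd (ht.2.1 t' ht'.1 h) ht'.2.2.not_gt
  refine (countable_iUnion hE).mono ?_
  rintro t ⟨⟨s, hs⟩, l, hl, hlt⟩
  obtain ⟨p, hp, hp'⟩ := exists_rat_btwn hlt
  obtain ⟨c, hc, hcsub⟩ := (mem_nhdsLT_iff_exists_Ioo_subset' hs).1
    (hl.eventually (eventually_lt_nhds hp))
  obtain ⟨q, hq, hq'⟩ := exists_rat_btwn (show (c : ℝ) < t from hc)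
  refine mem_iUnion.2 ⟨(q, p), hq', fun x hx hxt => hcsub ⟨?_, hxt⟩, hp'⟩
  exact Subtype.coe_lt_coe.1 (hq.trans hx)

theorem countable_not_continuousAt (hf : IsCadlag f) : {t | ¬ ContinuousAt f t}.Countable := by
  refine ((countable_leftLim_lt f).union (countable_leftLim_lt fun t => -f t)).mono ?_
  intro t ht
  obtain ⟨hr, l, hl⟩ := hf t
  -- At the left endpoint right-continuity is already continuity.
  have hs : ∃ s, s < t := by
    by_contra! h
    refine ht ?_
    have : Ici t = univ := eq_univ_of_forall h
    rwa [this, continuousWithinAt_univ] at hr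
  rcases lt_trichotomy l (f t) with h | h | h
  · exact Or.inl ⟨hs, l, hl, h⟩
  · refine absurd (continuousAt_iff_continuous_left'_right'.2 ⟨?_, hr.mono Ioi_subset_Ici_self⟩) ht
    rw [h] at hl
    exact hl
  · exact Or.inr ⟨hs, -l, hl.neg, neg_lt_neg h⟩

end IsCadlag

/-! ### The uniform norm and pointwise convergence in the Skorokhod space -/

namespace SkorokhodSpace

variable {a b : ℝ}

/-- The uniform norm of an element of `D[a,b]`. -/
noncomputable def supENorm (f : SkorokhodSpace a b) : ℝ≥0∞ := ⨆ t, ‖f t‖ₑ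

theorem enorm_le_supENorm (f : SkorokhodSpace a b) (t : Icc a b) : ‖f t‖ₑ ≤ supENorm f :=
  le_iSup (fun t => ‖f t‖ₑ) t

theorem supENorm_lt_top (f : SkorokhodSpace a b) : supENorm f < ∞ := by
  obtain ⟨M, hM⟩ := f.2.exists_abs_le
  refine lt_of_le_of_lt (iSup_le fun t => ?_) (ENNReal.ofReal_lt_top (r := M))
  rw [Real.enorm_eq_ofReal_abs]
  exact ENNReal.ofReal_le_ofReal (hM t)

theorem abs_le_toReal_supENorm (f : SkorokhodSpace a b) (t : Icc a b) :
    |f t| ≤ (supENorm f).toReal := by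
  have := ENNReal.toReal_mono (supENorm_lt_top f).ne (enorm_le_supENorm f t)
  simpa using this

theorem edist_def (f g : SkorokhodSpace a b) : edist f g = ⨅ τ : Icc a b ≃o Icc a b, cost τ f g :=
  rfl

theorem edist_le_iSup_edist (f g : SkorokhodSpace a b) : edist f g ≤ ⨆ t, edist (f t) (g t) := by
  refine (iInf_le _ (OrderIso.refl _)).trans ?_
  simp [cost]

/-- A time change permutes the points of `[a,b]` and so leaves the supremum unchanged; only the
vertical part of the cost matters. -/
theorem supENorm_le_add_edist (f g : SkorokhodSpace a b) :
    supENorm g ≤ supENorm f + edist f g := by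
  rw [edist_def, ENNReal.add_iInf]
  refine le_iInf fun τ => iSup_le fun t => ?_
  have h1 : edist (f (τ.symm t)) (g (τ (τ.symm t))) ≤ cost τ f g :=
    (le_iSup (fun t => edist (f t) (g (τ t))) _).trans le_sup_right
  rw [OrderIso.apply_symm_apply] at h1
  calc ‖g t‖ₑ = edist (g t) 0 := by simp
    _ ≤ edist (g t) (f (τ.symm t)) + edist (f (τ.symm t)) 0 := edist_triangle _ _ _
    _ ≤ cost τ f g + supENorm f := by
        refine add_le_add (by rwa [edist_comm]) ?_
        simpa using enorm_le_supENorm f (τ.symm t)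
    _ = _ := add_comm _ _

/-- Closedness is what the portmanteau inequality needs in order to bound the tails of the sup norm
by those of the limit. -/
theorem isClosed_le_supENorm (R : ℝ≥0∞) : IsClosed {f : SkorokhodSpace a b | R ≤ supENorm f} := by
  refine isClosed_of_closure_subset fun f hf => ?_
  refine ENNReal.le_of_forall_pos_le_add fun ε hε _ => ?_
  obtain ⟨g, hg, hfg⟩ := EMetric.mem_closure_iff.1 hf ε (by exact_mod_cast hε)
  exact (show R ≤ supENorm g from hg).trans
    ((supENorm_le_add_edist f g).trans (add_le_add le_rfl hfg.le))

/-- Convergence in the Skorokhod topology implies convergence at the continuity points of the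
limit. -/
theorem tendsto_apply {f : ℕ → SkorokhodSpace a b} {g : SkorokhodSpace a b}
    (hfg : Tendsto f atTop (𝓝 g)) {t : Icc a b} (ht : ContinuousAt g t) :
    Tendsto (fun n => f n t) atTop (𝓝 (g t)) := by
  rw [EMetric.tendsto_nhds]
  intro ε hε
  have hε2 : ε / 2 ≠ 0 := (ENNReal.half_pos hε.ne').ne'
  obtain ⟨δ, hδ, hδε⟩ := EMetric.continuousAt_iff.1 ht (ε / 2) (pos_iff_ne_zero.2 hε2)
  filter_upwards [EMetric.tendsto_nhds.1 hfg (min δ (ε / 2)) (lt_min hδ (pos_iff_ne_zero.2 hε2))]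
    with n hn
  rw [edist_def, iInf_lt_iff] at hn
  obtain ⟨τ, hτ⟩ := hn
  have h1 : edist (τ t) t < δ :=
    ((le_iSup (fun t => edist (τ t) t) t).trans le_sup_left).trans_lt
      (hτ.trans_le (min_le_left _ _))
  have h2 : edist (f n t) (g (τ t)) < ε / 2 :=
    ((le_iSup (fun t => edist (f n t) (g (τ t))) t).trans le_sup_right).trans_lt
      (hτ.trans_le (min_le_right _ _))
  calc edist (f n t) (g t) ≤ edist (f n t) (g (τ t)) + edist (g (τ t)) (g t) :=
        edist_triangle _ _ _
    _ < ε / 2 + ε / 2 := ENNReal.add_lt_add h2 (hδε h1)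
    _ = ε := ENNReal.add_halves ε

end SkorokhodSpace

/-! ### Slutsky's theorem and tightness -/

/-- **Slutsky's theorem** in a pseudo-emetric space: a sequence whose distance to a sequence
converging in distribution tends to zero in probability has the same limit in distribution. -/
theorem MeasureTheory.TendstoInDistribution.of_edist {Ω Ω' E : Type*} {mΩ : MeasurableSpace Ω}
    {mΩ' : MeasurableSpace Ω'} [PseudoEMetricSpace E] [MeasurableSpace E] [BorelSpace E]
    {P : Measure Ω} [IsProbabilityMeasure P] {P' : Measure Ω'} [IsProbabilityMeasure P']
    {X Y : ℕ → Ω → E} {Z : Ω' → E} (hX : TendstoInDistribution X atTop Z (fun _ => P) P')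
    (hY : ∀ n, AEMeasurable (Y n) P)
    (hXY : ∀ ε : ℝ, 0 < ε →
      Tendsto (fun n => P {ω | ENNReal.ofReal ε ≤ edist (Y n ω) (X n ω)}) atTop (𝓝 0)) :
    TendstoInDistribution Y atTop Z (fun _ => P) P' := by
  have hZ := hX.aemeasurable_limit
  refine ⟨hY, hZ, tendsto_of_forall_isClosed_limsup_le' fun F hF => ?_⟩
  simp only [ProbabilityMeasure.coe_mk]
  have hprob : IsProbabilityMeasure (P'.map Z) := Measure.isProbabilityMeasure_map hZ
  -- If `Y n` lies in `F`, then `X n` lies in the closed `ε`-thickening unless the two are at least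
  -- `ε` apart. The latter event need not be measurable; monotonicity and subadditivity of the outer
  -- measure suffice.
  have key : ∀ ε : ℝ, 0 < ε →
      limsup (fun n => (P.map (Y n)) F) atTop ≤ (P'.map Z) (Metric.cthickening ε F) := by
    intro ε hε
    have hle : ∀ n, (P.map (Y n)) F ≤ (P.map (X n)) (Metric.cthickening ε F) +
        P {ω | ENNReal.ofReal ε ≤ edist (Y n ω) (X n ω)} := by
      intro n
      rw [Measure.map_apply_of_aemeasurable (hY n) hF.measurableSet,
        Measure.map_apply_of_aemeasurable (hX.forall_aemeasurable n)
          Metric.isClosed_cthickening.measurableSet]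
      refine (measure_mono fun ω hω => ?_).trans (measure_union_le _ _)
      rcases le_total (ENNReal.ofReal ε) (edist (Y n ω) (X n ω)) with h | h
      · exact Or.inr h
      · refine Or.inl (Metric.mem_cthickening_of_edist_le (X n ω) (Y n ω) ε F hω ?_)
        rwa [edist_comm]
    calc limsup (fun n => (P.map (Y n)) F) atTop
        ≤ limsup (fun n => (P.map (X n)) (Metric.cthickening ε F) +
          P {ω | ENNReal.ofReal ε ≤ edist (Y n ω) (X n ω)}) atTop :=
          limsup_le_limsup (Eventually.of_forall hle)
      _ = limsup (fun n => (P.map (X n)) (Metric.cthickening ε F)) atTop :=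
          ENNReal.limsup_add_of_right_tendsto_zero (hXY ε hε) _
      _ ≤ _ := ProbabilityMeasure.limsup_measure_closed_le_of_tendsto hX.tendsto
          Metric.isClosed_cthickening
  -- As `ε` decreases to zero, the thickenings of a closed set shrink to the set itself.
  have hlim : Tendsto (fun r => (P'.map Z) (Metric.cthickening r F)) (𝓝[>] 0)
      (𝓝 ((P'.map Z) F)) :=
    (tendsto_measure_cthickening_of_isClosed ⟨1, one_pos, measure_ne_top _ _⟩ hF).mono_left
      nhdsWithin_le_nhds
  exact ge_of_tendsto hlim (eventually_mem_nhdsWithin.mono key)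

theorem MeasureTheory.tendsto_measure_le_abs {Ω : Type*} [MeasurableSpace Ω] {P : Measure Ω}
    [IsFiniteMeasure P] {V : Ω → ℝ} (hV : AEMeasurable V P) :
    Tendsto (fun R : ℕ => P {ω | (R : ℝ) ≤ |V ω|}) atTop (𝓝 0) := by
  have hmeas : ∀ R : ℕ, MeasurableSet {x : ℝ | (R : ℝ) ≤ |x|} := fun R =>
    measurableSet_le measurable_const measurable_id.abs
  have h := tendsto_measure_iInter_atTop (μ := P.map V) (s := fun R : ℕ => {x : ℝ | (R : ℝ) ≤ |x|})
    (fun R => (hmeas R).nullMeasurableSet)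
    (fun R S hRS x hx => (Nat.cast_le.2 hRS).trans (show (S : ℝ) ≤ |x| from hx))
    ⟨0, measure_ne_top _ _⟩
  have hempty : ⋂ R : ℕ, {x : ℝ | (R : ℝ) ≤ |x|} = ∅ := by
    refine eq_empty_of_forall_notMem fun x hx => ?_
    obtain ⟨n, hn⟩ := exists_nat_gt |x|
    exact hn.not_ge (mem_iInter.1 hx n)
  rw [hempty, measure_empty] at h
  refine h.congr fun R => ?_
  exact Measure.map_apply_of_aemeasurable hV (hmeas R)

namespace SkorokhodSpace

variable {a b : ℝ}

/-- A sequence converging in distribution in the Skorokhod space is tight in the uniform norm. -/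
theorem tendsto_measure_mul_supENorm {Ω Ω' : Type*} [MeasurableSpace Ω] [MeasurableSpace Ω']
    {P : Measure Ω} [IsProbabilityMeasure P] {P' : Measure Ω'} [IsProbabilityMeasure P']
    {X : ℕ → Ω → SkorokhodSpace a b} {Z : Ω' → SkorokhodSpace a b}
    (hX : TendstoInDistribution X atTop Z (fun _ => P) P') {V : Ω → ℝ} (hV : AEMeasurable V P)
    {e : ℕ → ℝ} (he : Tendsto e atTop (𝓝 0)) {ε : ℝ} (hε : 0 < ε) :
    Tendsto (fun n => P {ω | ε ≤ e n * (1 + (supENorm (X n ω)).toReal + |V ω|)}) atTop (𝓝 0) := by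
  have hZ := hX.aemeasurable_limit
  have hprob : IsProbabilityMeasure (P'.map Z) := Measure.isProbabilityMeasure_map hZ
  have hZt : Tendsto (fun R : ℕ => (P'.map Z) {f | (R : ℝ≥0∞) ≤ supENorm f}) atTop (𝓝 0) := by
    have h := tendsto_measure_iInter_atTop (μ := P'.map Z)
      (s := fun R : ℕ => {f : SkorokhodSpace a b | (R : ℝ≥0∞) ≤ supENorm f})
      (fun R => (isClosed_le_supENorm _).measurableSet.nullMeasurableSet)
      (fun R S hRS f hf => (Nat.cast_le.2 hRS).trans (show (S : ℝ≥0∞) ≤ supENorm f from hf))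
      ⟨0, measure_ne_top _ _⟩
    have hempty : ⋂ R : ℕ, {f : SkorokhodSpace a b | (R : ℝ≥0∞) ≤ supENorm f} = ∅ := by
      refine eq_empty_of_forall_notMem fun f hf => ?_
      obtain ⟨n, hn⟩ := ENNReal.exists_nat_gt (supENorm_lt_top f).ne
      exact hn.not_ge (mem_iInter.1 hf n)
    rwa [hempty, measure_empty] at h
  rw [ENNReal.tendsto_nhds_zero]
  intro δ hδ
  have hδ2 : 0 < δ / 2 := ENNReal.half_pos hδ.ne'
  -- One level `R` serves for the limit law and for `V`; the portmanteau inequality then transfers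
  -- the first bound to `X n`. Where neither level is reached the product is at most `|e n| (1 + 2
  -- R)`, eventually below `ε`.
  obtain ⟨R, hR, hR'⟩ := ((hZt.eventually (eventually_lt_nhds hδ2)).and
    ((tendsto_measure_le_abs hV).eventually (eventually_lt_nhds hδ2))).exists
  have hlim := (ProbabilityMeasure.limsup_measure_closed_le_of_tendsto hX.tendsto
    (isClosed_le_supENorm (a := a) (b := b) (R : ℝ≥0∞))).trans_lt hR
  have hev := eventually_lt_of_limsup_lt hlim
  have hsmall : ∀ᶠ n in atTop, |e n| * (1 + R + R) < ε := by
    have : Tendsto (fun n => |e n| * (1 + (R : ℝ) + R)) atTop (𝓝 0) := by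
      simpa using he.abs.mul_const (1 + (R : ℝ) + R)
    exact this.eventually (eventually_lt_nhds hε)
  filter_upwards [hev, hsmall] with n hn hsn
  simp only [ProbabilityMeasure.coe_mk] at hn
  rw [Measure.map_apply_of_aemeasurable (hX.forall_aemeasurable n)
    (isClosed_le_supENorm _).measurableSet] at hn
  calc P {ω | ε ≤ e n * (1 + (supENorm (X n ω)).toReal + |V ω|)}
      ≤ P (X n ⁻¹' {f | (R : ℝ≥0∞) ≤ supENorm f} ∪ {ω | (R : ℝ) ≤ |V ω|}) := by
        refine measure_mono fun ω hω => ?_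
        by_contra hnot
        simp only [mem_union, mem_preimage, mem_ofPred_eq, not_or, not_le] at hnot hω
        have h1 : (supENorm (X n ω)).toReal ≤ R := by
          have := ENNReal.toReal_mono (ENNReal.natCast_ne_top R) hnot.1.le
          simpa using this
        have h0 : 0 ≤ (supENorm (X n ω)).toReal := ENNReal.toReal_nonneg
        have h2 : e n * (1 + (supENorm (X n ω)).toReal + |V ω|) ≤ |e n| * (1 + R + R) := by
          refine mul_le_mul (le_abs_self _) ?_ (by positivity) (abs_nonneg _)
          linarith [hnot.2]
        linarith
    _ ≤ δ / 2 + δ / 2 := (measure_union_le _ _).trans (add_le_add hn.le hR'.le)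
    _ = δ := ENNReal.add_halves δ

end SkorokhodSpace

/-! ### Riemann sums and the smoothing functional -/

theorem intervalIntegrable_of_abs_le {F : ℝ → ℝ} {a b M : ℝ} (hF : Measurable F)
    (hM : ∀ r ∈ uIoc a b, |F r| ≤ M) : IntervalIntegrable F volume a b :=
  intervalIntegrable_iff.2 <|
    Measure.integrableOn_of_bounded (M := M) (by simp [uIoc]) hF.aestronglyMeasurable
      ((ae_restrict_iff' measurableSet_uIoc).2 (Eventually.of_forall hM))

theorem IntervalIntegrable.mono_zero_one {F : ℝ → ℝ} (hF : IntervalIntegrable F volume 0 1)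
    {x y : ℝ} (hx : x ∈ Icc (0 : ℝ) 1) (hy : y ∈ Icc (0 : ℝ) 1) :
    IntervalIntegrable F volume x y := by
  refine hF.mono_set ?_
  rw [uIcc_of_le zero_le_one]
  exact uIcc_subset_Icc hx hy

theorem Nat.measurable_comp_floor_mul (g : ℕ → ℝ) (c : ℝ) : Measurable fun r : ℝ => g ⌊c * r⌋₊ :=
  measurable_from_top.comp (Nat.measurable_floor.comp (measurable_id.const_mul c))

theorem Nat.floor_natCast_mul_le {N : ℕ} {r : ℝ} (hr : r ≤ 1) : ⌊(N : ℝ) * r⌋₊ ≤ N :=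
  Nat.floor_le_of_le (mul_le_of_le_one_right N.cast_nonneg hr)

theorem integral_comp_floor_mul {N : ℕ} (hN : 0 < N) (g : ℕ → ℝ) (n : ℕ) :
    ∫ r in (0 : ℝ)..(n / N), g ⌊(N : ℝ) * r⌋₊ = (N : ℝ)⁻¹ * ∑ i ∈ Finset.range n, g i := by
  have hN' : (0 : ℝ) < N := Nat.cast_pos.2 hN
  have hle : ∀ k : ℕ, (k : ℝ) / N ≤ ((k + 1 : ℕ) : ℝ) / N := fun k => by
    push_cast
    gcongr
    linarith
  have hfloor : ∀ k : ℕ, EqOn (fun r : ℝ => g ⌊(N : ℝ) * r⌋₊) (fun _ => g k)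
      (Ioo ((k : ℝ) / N) (((k + 1 : ℕ) : ℝ) / N)) := by
    intro k r hr
    have h1 := (div_lt_iff₀' hN').1 hr.1
    have h2 := (lt_div_iff₀' hN').1 hr.2
    push_cast at h2
    have : ⌊(N : ℝ) * r⌋₊ = k := (Nat.floor_eq_iff (k.cast_nonneg.trans h1.le)).2 ⟨h1.le, h2⟩
    simp only [this]
  have hint : ∀ k < n, IntervalIntegrable (fun r : ℝ => g ⌊(N : ℝ) * r⌋₊) volume
      ((k : ℝ) / N) (((k + 1 : ℕ) : ℝ) / N) := by
    intro k _
    rw [intervalIntegrable_iff_integrableOn_Ioo_of_le (hle k)]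
    exact (integrableOn_const (C := g k) (by simp)).congr_fun (hfloor k).symm measurableSet_Ioo
  have h := intervalIntegral.sum_integral_adjacent_intervals (a := fun k : ℕ => (k : ℝ) / N) hint
  simp only [Nat.cast_zero, zero_div] at h
  rw [← h, Finset.mul_sum]
  refine Finset.sum_congr rfl fun k _ => ?_
  rw [intervalIntegral.integral_congr_Ioo_of_le (hle k) (hfloor k)]
  simp only [intervalIntegral.integral_const, smul_eq_mul]
  push_cast
  field_simp
  ring

/-- The smoothing functional `∫_0^s K(ζ(r-s)) F(r) dr`. -/
noncomputable def kernelIntegral (K : ℝ → ℝ) (ζ : ℝ) (F : ℝ → ℝ) (s : ℝ) : ℝ :=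
  ∫ r in 0..s, K (ζ * (r - s)) * F r

section KernelIntegral

variable {K : ℝ → ℝ} {L C ζ : ℝ} {F F' : ℝ → ℝ} {s M : ℝ}

theorem continuous_of_abs_sub_le (hL : ∀ z w, |K z - K w| ≤ L * |z - w|) : Continuous K := by
  have h : LipschitzWith L.toNNReal K := LipschitzWith.of_dist_le_mul fun z w => by
    rw [Real.dist_eq, Real.dist_eq]
    exact (hL z w).trans (mul_le_mul_of_nonneg_right (Real.le_coe_toNNReal L) (abs_nonneg _))
  exact h.continuous

theorem intervalIntegrable_kernel_mul (hK : Continuous K) (ζ : ℝ) (s : ℝ)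
    (hF : IntervalIntegrable F volume 0 1) {x y : ℝ} (hx : x ∈ Icc (0 : ℝ) 1)
    (hy : y ∈ Icc (0 : ℝ) 1) :
    IntervalIntegrable (fun r => K (ζ * (r - s)) * F r) volume x y :=
  (hF.mono_zero_one hx hy).continuousOn_mul (by fun_prop)

/-- The argument of `K` stays within distance `ζ` of zero, so the Lipschitz bound alone controls the
kernel. -/
theorem abs_kernel_le (hL : ∀ z w, |K z - K w| ≤ L * |z - w|) (hL0 : 0 ≤ L) (hζ : 0 ≤ ζ) {r : ℝ}
    (hr : r ∈ Icc (0 : ℝ) 1) (hs : s ∈ Icc (0 : ℝ) 1) :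
    |K (ζ * (r - s))| ≤ |K 0| + L * ζ := by
  have h1 := hL (ζ * (r - s)) 0
  have h2 : |r - s| ≤ 1 := abs_le.2 ⟨by linarith [hr.1, hs.2], by linarith [hr.2, hs.1]⟩
  rw [sub_zero, abs_mul, abs_of_nonneg hζ] at h1
  have h3 : L * (ζ * |r - s|) ≤ L * ζ := by
    rw [← mul_assoc]
    exact mul_le_of_le_one_right (by positivity) h2
  have h4 := abs_sub_abs_le_abs_sub (K (ζ * (r - s))) (K 0)
  linarith

theorem kernelIntegral_sub (hK : Continuous K) (ζ : ℝ) (hF : IntervalIntegrable F volume 0 1)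
    (hF' : IntervalIntegrable F' volume 0 1) (hs : s ∈ Icc (0 : ℝ) 1) :
    kernelIntegral K ζ (fun r => F r - F' r) s = kernelIntegral K ζ F s - kernelIntegral K ζ F' s := by
  have h0 : (0 : ℝ) ∈ Icc (0 : ℝ) 1 := ⟨le_rfl, zero_le_one⟩
  rw [kernelIntegral, kernelIntegral, kernelIntegral, ← intervalIntegral.integral_sub
    (intervalIntegrable_kernel_mul hK ζ s hF h0 hs)
    (intervalIntegrable_kernel_mul hK ζ s hF' h0 hs)]
  exact intervalIntegral.integral_congr fun r _ => mul_sub _ _ _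

theorem kernelIntegral_add (hK : Continuous K) (ζ : ℝ) (hF : IntervalIntegrable F volume 0 1)
    (hF' : IntervalIntegrable F' volume 0 1) (hs : s ∈ Icc (0 : ℝ) 1) :
    kernelIntegral K ζ (fun r => F r + F' r) s = kernelIntegral K ζ F s + kernelIntegral K ζ F' s := by
  have h0 : (0 : ℝ) ∈ Icc (0 : ℝ) 1 := ⟨le_rfl, zero_le_one⟩
  simp only [kernelIntegral, mul_add]
  exact intervalIntegral.integral_add (intervalIntegrable_kernel_mul hK ζ s hF h0 hs)
    (intervalIntegrable_kernel_mul hK ζ s hF' h0 hs)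

theorem kernelIntegral_const_mul (K : ℝ → ℝ) (ζ c : ℝ) (F : ℝ → ℝ) (s : ℝ) :
    kernelIntegral K ζ (fun r => c * F r) s = c * kernelIntegral K ζ F s := by
  simp only [kernelIntegral, mul_left_comm _ c]
  exact intervalIntegral.integral_const_mul _ _

theorem kernelIntegral_one_eq (K : ℝ → ℝ) (ζ s : ℝ) :
    kernelIntegral K ζ (fun _ => 1) s = ∫ r in 0..s, K (ζ * (r - s)) := by
  simp [kernelIntegral]

theorem kernelIntegral_congr {K : ℝ → ℝ} {ζ : ℝ} (hs : s ∈ Icc (0 : ℝ) 1)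
    (h : ∀ r ∈ Icc (0 : ℝ) 1, F r = F' r) : kernelIntegral K ζ F s = kernelIntegral K ζ F' s := by
  refine intervalIntegral.integral_congr fun r hr => ?_
  rw [uIcc_of_le hs.1] at hr
  simp only [h r ⟨hr.1, hr.2.trans hs.2⟩]

/-- Since `K` is nonnegative, the bound is a multiple of the normalising integral, which cancels in
quotients. -/
theorem abs_kernelIntegral_le_mul (hK : Continuous K) (hK0 : ∀ z, 0 ≤ K z) (ζ : ℝ)
    (hs : s ∈ Icc (0 : ℝ) 1) (hM : ∀ r ∈ Icc (0 : ℝ) 1, |F r| ≤ M) :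
    |kernelIntegral K ζ F s| ≤ M * kernelIntegral K ζ (fun _ => 1) s := by
  rw [← kernelIntegral_const_mul, ← Real.norm_eq_abs]
  refine intervalIntegral.norm_integral_le_of_norm_le (g := fun r => K (ζ * (r - s)) * (M * 1))
    hs.1 (Eventually.of_forall fun r hr => ?_) ?_
  · rw [norm_mul, Real.norm_of_nonneg (hK0 _), mul_one]
    exact mul_le_mul_of_nonneg_left (hM r ⟨hr.1.le, hr.2.trans hs.2⟩) (hK0 _)
  · exact Continuous.intervalIntegrable (by fun_prop) _ _

/-- This `L¹` bound, uniform in `s`, gives continuity of smoothing for the Skorokhod topology. -/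
theorem abs_kernelIntegral_le_integral (hL : ∀ z w, |K z - K w| ≤ L * |z - w|) (hL0 : 0 ≤ L)
    (hζ : 0 ≤ ζ) (hs : s ∈ Icc (0 : ℝ) 1) (hF : IntervalIntegrable F volume 0 1) :
    |kernelIntegral K ζ F s| ≤ (|K 0| + L * ζ) * ∫ r in (0 : ℝ)..1, |F r| := by
  have h0 : (0 : ℝ) ∈ Icc (0 : ℝ) 1 := ⟨le_rfl, zero_le_one⟩
  calc |kernelIntegral K ζ F s| ≤ ∫ r in 0..s, (|K 0| + L * ζ) * |F r| := by
        rw [← Real.norm_eq_abs]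
        refine intervalIntegral.norm_integral_le_of_norm_le hs.1 (Eventually.of_forall fun r hr => ?_)
          ((hF.mono_zero_one h0 hs).abs.const_mul _)
        rw [norm_mul]
        exact mul_le_mul_of_nonneg_right (abs_kernel_le hL hL0 hζ ⟨hr.1.le, hr.2.trans hs.2⟩ hs)
          (norm_nonneg _)
    _ = (|K 0| + L * ζ) * ∫ r in 0..s, |F r| := intervalIntegral.integral_const_mul _ _
    _ ≤ _ := mul_le_mul_of_nonneg_left (intervalIntegral.integral_mono_interval le_rfl hs.1 hs.2
        (Eventually.of_forall fun r => abs_nonneg _) hF.abs) (by positivity)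

theorem abs_kernelIntegral_sub_le (hL : ∀ z w, |K z - K w| ≤ L * |z - w|) (hL0 : 0 ≤ L)
    (hζ : 0 ≤ ζ) (hF : IntervalIntegrable F volume 0 1) (hM : ∀ r ∈ Icc (0 : ℝ) 1, |F r| ≤ M)
    {s t : ℝ} (hs : s ∈ Icc (0 : ℝ) 1) (ht : t ∈ Icc (0 : ℝ) 1) :
    |kernelIntegral K ζ F t - kernelIntegral K ζ F s| ≤
      ((|K 0| + L * ζ) * M + L * ζ * M) * |t - s| := by
  have h0 : (0 : ℝ) ∈ Icc (0 : ℝ) 1 := ⟨le_rfl, zero_le_one⟩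
  have hK := continuous_of_abs_sub_le hL
  have hM0 : 0 ≤ M := (abs_nonneg _).trans (hM 0 h0)
  -- The increment comes from the extra stretch of integration, where the kernel is bounded, and
  -- from the shift of the kernel, where it is Lipschitz.
  have hdecomp : kernelIntegral K ζ F t - kernelIntegral K ζ F s =
      (∫ r in s..t, K (ζ * (r - t)) * F r) +
        ∫ r in 0..s, (K (ζ * (r - t)) - K (ζ * (r - s))) * F r := by
    simp only [sub_mul]
    rw [intervalIntegral.integral_sub (intervalIntegrable_kernel_mul hK ζ t hF h0 hs)
      (intervalIntegrable_kernel_mul hK ζ s hF h0 hs), kernelIntegral, kernelIntegral,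
      ← intervalIntegral.integral_add_adjacent_intervals
        (intervalIntegrable_kernel_mul hK ζ t hF h0 hs)
        (intervalIntegrable_kernel_mul hK ζ t hF hs ht)]
    ring
  have h1 : ‖∫ r in s..t, K (ζ * (r - t)) * F r‖ ≤ (|K 0| + L * ζ) * M * |t - s| := by
    refine intervalIntegral.norm_integral_le_of_norm_le_const fun r hr => ?_
    have hr' : r ∈ Icc (0 : ℝ) 1 := uIcc_subset_Icc hs ht (uIoc_subset_uIcc hr)
    rw [norm_mul]
    exact mul_le_mul (abs_kernel_le hL hL0 hζ hr' ht) (hM r hr') (norm_nonneg _) (by positivity)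
  have h2 : ‖∫ r in 0..s, (K (ζ * (r - t)) - K (ζ * (r - s))) * F r‖ ≤
      L * ζ * |t - s| * M * |s - 0| := by
    refine intervalIntegral.norm_integral_le_of_norm_le_const fun r hr => ?_
    have hr' : r ∈ Icc (0 : ℝ) 1 := uIcc_subset_Icc h0 hs (uIoc_subset_uIcc hr)
    rw [norm_mul]
    refine mul_le_mul ((hL _ _).trans (le_of_eq ?_)) (hM r hr') (norm_nonneg _) (by positivity)
    rw [← mul_sub, abs_mul, abs_of_nonneg hζ, sub_sub_sub_cancel_left, abs_sub_comm s t, mul_assoc]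
  have h3 : L * ζ * |t - s| * M * |s - 0| ≤ L * ζ * |t - s| * M * 1 := by
    refine mul_le_mul_of_nonneg_left ?_ (by positivity)
    rw [sub_zero, abs_of_nonneg hs.1]
    exact hs.2
  rw [Real.norm_eq_abs] at h1 h2
  rw [hdecomp]
  refine (abs_add_le _ _).trans ?_
  linarith

theorem continuousOn_kernelIntegral (hL : ∀ z w, |K z - K w| ≤ L * |z - w|) (hL0 : 0 ≤ L)
    (hζ : 0 ≤ ζ) (hF : IntervalIntegrable F volume 0 1) (hM : ∀ r ∈ Icc (0 : ℝ) 1, |F r| ≤ M) :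
    ContinuousOn (kernelIntegral K ζ F) (Icc 0 1) := by
  have hM0 : 0 ≤ M := (abs_nonneg _).trans (hM 0 ⟨le_rfl, zero_le_one⟩)
  refine (LipschitzOnWith.of_dist_le_mul
    (K := ⟨(|K 0| + L * ζ) * M + L * ζ * M, by positivity⟩) fun s hs t ht => ?_).continuousOn
  rw [Real.dist_eq, Real.dist_eq]
  exact abs_kernelIntegral_sub_le hL hL0 hζ hF hM ht hs

/-- The normalising integral is nonnegative and continuous in `s`, so its minimum over the compact
interval is attained and cannot be zero. -/
theorem exists_pos_le_kernelIntegral_one (hL : ∀ z w, |K z - K w| ≤ L * |z - w|) (hL0 : 0 ≤ L)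
    (hK0 : ∀ z, 0 ≤ K z) (hζ : 0 ≤ ζ) {a : ℝ} (ha0 : 0 ≤ a)
    (hden : ∀ s ∈ Icc a 1, kernelIntegral K ζ (fun _ => 1) s ≠ 0) :
    ∃ d, 0 < d ∧ ∀ s ∈ Icc a 1, d ≤ kernelIntegral K ζ (fun _ => 1) s := by
  have hsub : Icc a 1 ⊆ Icc (0 : ℝ) 1 := Icc_subset_Icc_left ha0
  rcases (Icc a (1 : ℝ)).eq_empty_or_nonempty with he | hne
  · exact ⟨1, one_pos, by simp [he]⟩
  obtain ⟨t, ht, hmin⟩ := isCompact_Icc.exists_isMinOn hne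
    ((continuousOn_kernelIntegral (F := fun _ => 1) (M := 1) hL hL0 hζ (by simp) (by simp)).mono
      hsub)
  refine ⟨_, lt_of_le_of_ne ?_ (hden t ht).symm, fun s hs => hmin hs⟩
  exact intervalIntegral.integral_nonneg (hsub ht).1 fun r _ => mul_nonneg (hK0 _) zero_le_one

/-- The weighted Riemann sums of the sequential smoother approximate the smoothing functional,
uniformly over bounded weights. -/
theorem abs_riemannSum_sub_kernelIntegral_le (hL : ∀ z w, |K z - K w| ≤ L * |z - w|) (hL0 : 0 ≤ L)
    (hζ : 0 ≤ ζ) {N : ℕ} (hN : 0 < N) {h : ℝ} (hh : 0 < h) (x : ℕ → ℝ)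
    (hx : ∀ i, 1 ≤ i → i ≤ N + 1 → |x i| ≤ M) (hs : s ∈ Icc (0 : ℝ) 1) :
    |(N : ℝ)⁻¹ * ∑ i ∈ Finset.Icc 1 ⌊(N : ℝ) * s⌋₊, K (((i : ℝ) - (⌊(N : ℝ) * s⌋₊ : ℝ)) / h) * x i -
        kernelIntegral K ζ (fun r => x (⌊(N : ℝ) * r⌋₊ + 1)) s| ≤
      (L * (2 / h + |N / h - ζ|) + (|K 0| + L * ζ) / N) * M := by
  have hN' : (0 : ℝ) < N := Nat.cast_pos.2 hN
  have h0 : (0 : ℝ) ∈ Icc (0 : ℝ) 1 := ⟨le_rfl, zero_le_one⟩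
  have hM0 : 0 ≤ M := (abs_nonneg _).trans (hx 1 le_rfl (by omega))
  have hK := continuous_of_abs_sub_le hL
  set n := ⌊(N : ℝ) * s⌋₊ with hn
  -- With the index shifted by one, the sum over `1, …, n` becomes an integral over `[0, n / N]`.
  -- The value at `r = 1` is `x (N + 1)`, hence the range of indices in `hx`.
  set F : ℝ → ℝ := fun r => x (⌊(N : ℝ) * r⌋₊ + 1) with hFdef
  have hFm : Measurable F := Nat.measurable_comp_floor_mul (fun i => x (i + 1)) N
  have hFb : ∀ r ∈ Icc (0 : ℝ) 1, |F r| ≤ M := fun r hr =>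
    hx _ (by omega) (by have := Nat.floor_natCast_mul_le (N := N) hr.2; omega)
  have hF : IntervalIntegrable F volume 0 1 := intervalIntegrable_of_abs_le hFm fun r hr =>
    hFb r (by rw [uIoc_of_le zero_le_one] at hr; exact Ioc_subset_Icc_self hr)
  have hns : (n : ℝ) ≤ N * s := Nat.floor_le (by have := hs.1; positivity)
  have hns' : N * s < n + 1 := Nat.lt_floor_add_one _
  have hq : (n : ℝ) / N ≤ s := (div_le_iff₀' hN').2 hns
  have hq' : s - (n : ℝ) / N ≤ 1 / N := by
    rw [sub_le_iff_le_add, ← add_div, le_div_iff₀' hN']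
    linarith
  have hqm : (n : ℝ) / N ∈ Icc (0 : ℝ) 1 := ⟨by positivity, hq.trans hs.2⟩
  have hsum : (N : ℝ)⁻¹ * ∑ i ∈ Finset.Icc 1 n, K (((i : ℝ) - n) / h) * x i =
      ∫ r in (0 : ℝ)..(n / N), K (((⌊(N : ℝ) * r⌋₊ + 1 : ℕ) - (n : ℝ)) / h) * F r := by
    rw [integral_comp_floor_mul hN (fun i => K (((i + 1 : ℕ) - (n : ℝ)) / h) * x (i + 1))]
    congr 1
    rw [Finset.range_eq_Ico, Finset.sum_Ico_add' (fun i : ℕ => K (((i : ℕ) - (n : ℝ)) / h) * x i)]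
    rfl
  have hmeas1 : Measurable fun r : ℝ =>
      K (((⌊(N : ℝ) * r⌋₊ + 1 : ℕ) - (n : ℝ)) / h) * F r :=
    Nat.measurable_comp_floor_mul (fun i => K (((i + 1 : ℕ) - (n : ℝ)) / h) * x (i + 1)) N
  -- The term `2 / h` accounts for two roundings, of `N r` and of `N s`, each by at most one; `|N /
  -- h - ζ|` is the error of the scale.
  have hclose : ∀ r ∈ Icc (0 : ℝ) 1,
      |K (((⌊(N : ℝ) * r⌋₊ + 1 : ℕ) - (n : ℝ)) / h) - K (ζ * (r - s))| ≤
        L * (2 / h + |N / h - ζ|) := by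
    intro r hr
    refine (hL _ _).trans (mul_le_mul_of_nonneg_left ?_ hL0)
    have hr1 : (⌊(N : ℝ) * r⌋₊ : ℝ) ≤ N * r := Nat.floor_le (by have := hr.1; positivity)
    have hr2 : N * r < ⌊(N : ℝ) * r⌋₊ + 1 := Nat.lt_floor_add_one _
    have heq : ((⌊(N : ℝ) * r⌋₊ + 1 : ℕ) - (n : ℝ)) / h - ζ * (r - s) =
        ((⌊(N : ℝ) * r⌋₊ + 1 - N * r) + (N * s - n)) / h + (N / h - ζ) * (r - s) := by
      push_cast
      field_simp
      ring
    rw [heq]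
    refine (abs_add_le _ _).trans (add_le_add ?_ ?_)
    · rw [abs_div, abs_of_pos hh]
      gcongr
      rw [abs_le]
      constructor <;> linarith
    · rw [abs_mul]
      refine mul_le_of_le_one_right (abs_nonneg _) (abs_le.2 ⟨?_, ?_⟩)
      · linarith [hr.1, hs.2]
      · linarith [hr.2, hs.1]
  have hdecomp : (N : ℝ)⁻¹ * ∑ i ∈ Finset.Icc 1 n, K (((i : ℝ) - n) / h) * x i -
        kernelIntegral K ζ F s =
      (∫ r in (0 : ℝ)..(n / N),
        (K (((⌊(N : ℝ) * r⌋₊ + 1 : ℕ) - (n : ℝ)) / h) - K (ζ * (r - s))) * F r) -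
        ∫ r in (n / N : ℝ)..s, K (ζ * (r - s)) * F r := by
    rw [hsum, kernelIntegral, ← intervalIntegral.integral_add_adjacent_intervals
        (intervalIntegrable_kernel_mul hK ζ s hF h0 hqm)
        (intervalIntegrable_kernel_mul hK ζ s hF hqm hs)]
    simp only [sub_mul]
    rw [intervalIntegral.integral_sub _ (intervalIntegrable_kernel_mul hK ζ s hF h0 hqm)]
    · ring
    · refine intervalIntegrable_of_abs_le (M := (L * (2 / h + |N / h - ζ|) + (|K 0| + L * ζ)) * M)
        hmeas1 fun r hr => ?_
      have hr' : r ∈ Icc (0 : ℝ) 1 := uIcc_subset_Icc h0 hqm (uIoc_subset_uIcc hr)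
      rw [abs_mul]
      refine mul_le_mul ?_ (hFb r hr') (abs_nonneg _) (by positivity)
      have h1 := hclose r hr'
      have h2 := abs_kernel_le hL hL0 hζ hr' hs
      have h3 := abs_sub_abs_le_abs_sub
        (K (((⌊(N : ℝ) * r⌋₊ + 1 : ℕ) - (n : ℝ)) / h)) (K (ζ * (r - s)))
      linarith
  have e1 : ‖∫ r in (0 : ℝ)..(n / N),
      (K (((⌊(N : ℝ) * r⌋₊ + 1 : ℕ) - (n : ℝ)) / h) - K (ζ * (r - s))) * F r‖ ≤
      L * (2 / h + |N / h - ζ|) * M * |(n / N : ℝ) - 0| := by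
    refine intervalIntegral.norm_integral_le_of_norm_le_const fun r hr => ?_
    have hr' : r ∈ Icc (0 : ℝ) 1 := uIcc_subset_Icc h0 hqm (uIoc_subset_uIcc hr)
    rw [norm_mul]
    exact mul_le_mul (hclose r hr') (hFb r hr') (norm_nonneg _) (by positivity)
  have e2 : ‖∫ r in (n / N : ℝ)..s, K (ζ * (r - s)) * F r‖ ≤
      (|K 0| + L * ζ) * M * |s - n / N| := by
    refine intervalIntegral.norm_integral_le_of_norm_le_const fun r hr => ?_
    have hr' : r ∈ Icc (0 : ℝ) 1 := uIcc_subset_Icc hqm hs (uIoc_subset_uIcc hr)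
    rw [norm_mul]
    exact mul_le_mul (abs_kernel_le hL hL0 hζ hr' hs) (hFb r hr') (norm_nonneg _) (by positivity)
  have e1' : L * (2 / h + |N / h - ζ|) * M * |(n / N : ℝ) - 0| ≤
      L * (2 / h + |N / h - ζ|) * M := by
    refine mul_le_of_le_one_right (by positivity) ?_
    rw [sub_zero, abs_of_nonneg hqm.1]
    exact hqm.2
  have e2' : (|K 0| + L * ζ) * M * |s - n / N| ≤ (|K 0| + L * ζ) * M * (1 / N) := by
    refine mul_le_mul_of_nonneg_left ?_ (by positivity)
    rwa [abs_of_nonneg (sub_nonneg.2 hq)]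
  rw [Real.norm_eq_abs] at e1 e2
  rw [hdecomp]
  refine (abs_sub _ _).trans ?_
  calc _ ≤ L * (2 / h + |N / h - ζ|) * M + (|K 0| + L * ζ) * M * (1 / N) := by linarith
    _ = _ := by ring

/-- The difference equals `((p' - p) - (p / q) (q' - q)) / q'`. Here `|p / q| ≤ M` bounds the
numerator by `2 η M`, and `η ≤ d / 2` keeps `q'` above `d / 2`. -/
theorem abs_div_sub_div_le {p q p' q' η d M : ℝ} (hp : |p' - p| ≤ η * M) (hq : |q' - q| ≤ η)
    (hd : 0 < d) (hdq : d ≤ q) (hη : η ≤ d / 2) (hpq : |p| ≤ M * q) :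
    |p' / q' - p / q| ≤ 4 * η / d * M := by
  have hq0 : 0 < q := hd.trans_le hdq
  have hM0 : 0 ≤ M := by
    by_contra! h
    exact absurd ((abs_nonneg p).trans hpq) (not_le.2 (mul_neg_of_neg_of_pos h hq0))
  have hη0 : 0 ≤ η := (abs_nonneg _).trans hq
  have hq' : d / 2 ≤ q' := by linarith [(abs_le.1 hq).1]
  have hq'0 : 0 < q' := (half_pos hd).trans_le hq'
  have heq : p' / q' - p / q = ((p' - p) - p / q * (q' - q)) / q' := by
    field_simp
    ring
  have hr : |p / q| ≤ M := by
    rw [abs_div, abs_of_pos hq0, div_le_iff₀ hq0]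
    exact hpq
  have hnum : |(p' - p) - p / q * (q' - q)| ≤ 2 * η * M := by
    refine (abs_sub _ _).trans ?_
    rw [abs_mul]
    have := mul_le_mul hr hq (abs_nonneg _) hM0
    linarith
  rw [heq, abs_div, abs_of_pos hq'0]
  calc |(p' - p) - p / q * (q' - q)| / q' ≤ 2 * η * M / (d / 2) := by gcongr
    _ = _ := by
      field_simp
      ring

/-- Kernel-weighted averages of a bounded sequence approximate the normalised smoothing
functional. -/
theorem abs_weightedAverage_sub_le (hL : ∀ z w, |K z - K w| ≤ L * |z - w|) (hL0 : 0 ≤ L)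
    (hK0 : ∀ z, 0 ≤ K z) (hζ : 0 ≤ ζ) {N : ℕ} (hN : 0 < N) {h : ℝ} (hh : 0 < h) (x : ℕ → ℝ)
    (hx : ∀ i, 1 ≤ i → i ≤ N + 1 → |x i| ≤ M) (hs : s ∈ Icc (0 : ℝ) 1) {d : ℝ} (hd : 0 < d)
    (hds : d ≤ kernelIntegral K ζ (fun _ => 1) s)
    (hη : L * (2 / h + |N / h - ζ|) + (|K 0| + L * ζ) / N ≤ d / 2) :
    |(∑ i ∈ Finset.Icc 1 ⌊(N : ℝ) * s⌋₊,
        rescaledKernel K h ((i : ℝ) - (⌊(N : ℝ) * s⌋₊ : ℝ)) * x i) /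
        (∑ i ∈ Finset.Icc 1 ⌊(N : ℝ) * s⌋₊, rescaledKernel K h ((i : ℝ) - (⌊(N : ℝ) * s⌋₊ : ℝ))) -
        kernelIntegral K ζ (fun r => x (⌊(N : ℝ) * r⌋₊ + 1)) s /
          kernelIntegral K ζ (fun _ => 1) s| ≤
      4 * (L * (2 / h + |N / h - ζ|) + (|K 0| + L * ζ) / N) / d * M := by
  have hN' : (0 : ℝ) < N := Nat.cast_pos.2 hN
  have h1 := abs_riemannSum_sub_kernelIntegral_le hL hL0 hζ hN hh x hx hs
  have h2 := abs_riemannSum_sub_kernelIntegral_le (M := 1) hL hL0 hζ hN hh (fun _ => 1)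
    (fun _ _ _ => by simp) hs
  simp only [mul_one] at h2
  have h3 := abs_kernelIntegral_le_mul (continuous_of_abs_sub_le hL) hK0 ζ hs
    (F := fun r => x (⌊(N : ℝ) * r⌋₊ + 1)) (M := M) fun r hr =>
      hx _ (by omega) (by have := Nat.floor_natCast_mul_le (N := N) hr.2; omega)
  have h4 := abs_div_sub_div_le h1 h2 hd hds hη h3
  -- The factors `N⁻¹` of the Riemann sums and `h⁻¹` of the rescaled kernel cancel between numerator
  -- and denominator.
  rw [mul_div_mul_left _ _ (inv_ne_zero hN'.ne')] at h4
  simp only [rescaledKernel, mul_assoc, ← Finset.mul_sum]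
  rwa [mul_div_mul_left _ _ (inv_ne_zero hh.ne')]

end KernelIntegral

/-! ### Riemann sums of the drift function -/

namespace PiecewiseContinuous

variable {f : ℝ → ℝ}

theorem countable_not_continuousAt (hf : PiecewiseContinuous f) :
    {t | ¬ ContinuousAt f t}.Countable := by
  refine (countable_iUnion fun n : ℕ => (hf.1 (-n) n).countable).mono fun t ht => ?_
  obtain ⟨n, hn⟩ := exists_nat_ge |t|
  exact mem_iUnion.2 ⟨n, abs_le.1 hn, ht⟩

theorem exists_abs_le (hf : PiecewiseContinuous f) (R : ℝ) :
    ∃ M, ∀ t, |t| ≤ R → |f t| ≤ M := by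
  obtain ⟨M, hM⟩ := (isCompact_Icc (a := -R) (b := R)).exists_abs_le_of_eventually (f := f)
    fun t _ => by
      obtain ⟨⟨l, hl⟩, r, hr⟩ := hf.2 t
      refine ⟨max (max (|l| + 1) (|r| + 1)) |f t|, ?_⟩
      rw [← nhdsNE_sup_pure t, ← nhdsLT_sup_nhdsGT t, eventually_sup, eventually_sup]
      exact ⟨⟨hl.eventually_abs_le.mono fun _ h => h.trans ((le_max_left _ _).trans (le_max_left _ _)),
        hr.eventually_abs_le.mono fun _ h => h.trans ((le_max_right _ _).trans (le_max_left _ _))⟩,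
        eventually_pure.2 (le_max_right _ _)⟩
  exact ⟨M, fun t ht => hM t (abs_le.1 ht)⟩

/-- Riemann sums of a piecewise continuous function with a converging shift approximate the
integral, uniformly in the upper limit of integration. -/
theorem exists_riemannSum_sub_integral_le (hf : PiecewiseContinuous f) {h : ℕ → ℝ} {ζ θ : ℝ}
    (hζ : 0 < ζ) (hh : ∀ N, 1 ≤ N → 0 < h N)
    (hNh : Tendsto (fun N : ℕ => (N : ℝ) / h N) atTop (𝓝 ζ)) {q : ℕ → ℝ}
    (hq : Tendsto (fun N : ℕ => q N / N) atTop (𝓝 θ)) :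
    ∃ e : ℕ → ℝ, Tendsto e atTop (𝓝 0) ∧
      IntervalIntegrable (fun y => f (ζ * y - ζ * θ)) volume 0 1 ∧
      ∀ᶠ N : ℕ in atTop, ∀ r ∈ Icc (0 : ℝ) 1,
        |(h N)⁻¹ * ∑ k ∈ Finset.Icc 1 ⌊(N : ℝ) * r⌋₊, f (((k : ℝ) - q N) / h N) -
          ∫ t in 0..(ζ * r), f (t - ζ * θ)| ≤ e N := by
  -- The radius bounds every argument of `f` that occurs: eventually `N / h ≤ ζ + 1`, while `(⌊N y⌋
  -- + 1) / N ≤ 2` and `|q / N| ≤ |θ| + 1`.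
  obtain ⟨M, hM⟩ := hf.exists_abs_le ((ζ + 1) * (2 + (|θ| + 1)))
  have hev : ∀ᶠ N : ℕ in atTop, 1 ≤ N ∧ (N : ℝ) / h N ≤ ζ + 1 ∧ |q N / N| ≤ |θ| + 1 :=
    (eventually_ge_atTop 1).and ((hNh.eventually (eventually_le_nhds (lt_add_one ζ))).and
      hq.eventually_abs_le)
  let g : ℕ → ℝ → ℝ := fun N y => f (((⌊(N : ℝ) * y⌋₊ + 1 : ℕ) - q N) / h N)
  let g₀ : ℝ → ℝ := fun y => f (ζ * y - ζ * θ)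
  have hgm : ∀ N, Measurable (g N) := fun N =>
    Nat.measurable_comp_floor_mul (fun k => f (((k + 1 : ℕ) - q N) / h N)) N
  have hg₀M : ∀ y ∈ Icc (0 : ℝ) 1, |g₀ y| ≤ M := fun y hy => hM _ <| by
    rw [← mul_sub, abs_mul, abs_of_pos hζ]
    refine mul_le_mul (by linarith) ?_ (abs_nonneg _) (by positivity)
    refine (abs_sub _ _).trans ?_
    rw [abs_of_nonneg hy.1]
    linarith [hy.2]
  have hgM : ∀ N : ℕ, (1 ≤ N ∧ (N : ℝ) / h N ≤ ζ + 1 ∧ |q N / N| ≤ |θ| + 1) →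
      ∀ y ∈ Icc (0 : ℝ) 1, |g N y| ≤ M := by
    rintro N ⟨hN1, hN2, hN3⟩ y hy
    have hN0 : (0 : ℝ) < N := by exact_mod_cast hN1
    have hh0 := hh N hN1
    refine hM _ ?_
    have heq : ((⌊(N : ℝ) * y⌋₊ + 1 : ℕ) - q N) / h N =
        (N / h N) * (((⌊(N : ℝ) * y⌋₊ + 1 : ℕ) : ℝ) / N - q N / N) := by
      field_simp
    rw [heq, abs_mul, abs_of_pos (div_pos hN0 hh0)]
    refine mul_le_mul hN2 ((abs_sub _ _).trans (add_le_add ?_ hN3)) (abs_nonneg _) (by positivity)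
    rw [abs_of_nonneg (by positivity), div_le_iff₀ hN0]
    have h1 : ⌊(N : ℝ) * y⌋₊ + 1 ≤ 2 * N := by
      have := Nat.floor_natCast_mul_le (N := N) hy.2
      omega
    exact_mod_cast h1
  -- The arguments converge to `ζ y - ζ θ`, which is a discontinuity of `f` for only countably many
  -- `y`.
  have hlim : ∀ᵐ y : ℝ, y ∈ uIoc (0 : ℝ) 1 → Tendsto (fun N => g N y) atTop (𝓝 (g₀ y)) := by
    have hc : ((fun y : ℝ => ζ * y - ζ * θ) ⁻¹' {t | ¬ ContinuousAt f t}).Countable :=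
      hf.countable_not_continuousAt.preimage fun x y hxy => by
        have : ζ * x = ζ * y := by simpa using hxy
        exact mul_left_cancel₀ hζ.ne' this
    filter_upwards [hc.ae_notMem volume] with y hy hy01
    have hcont : ContinuousAt f (ζ * y - ζ * θ) := not_not.1 hy
    rw [uIoc_of_le zero_le_one] at hy01
    refine hcont.tendsto.comp ?_
    have hfl : Tendsto (fun N : ℕ => (⌊y * (N : ℝ)⌋₊ : ℝ) / N) atTop (𝓝 y) :=
      (tendsto_nat_floor_mul_div_atTop hy01.1.le).comp tendsto_natCast_atTop_atTop
    have h1 := hNh.mul ((hfl.add (tendsto_one_div_atTop_nhds_zero_nat (𝕜 := ℝ))).sub hq)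
    rw [add_zero, mul_sub] at h1
    refine h1.congr' ?_
    filter_upwards [eventually_ge_atTop 1] with N hN
    have hN0 : (0 : ℝ) < N := by exact_mod_cast hN
    have hh0 := hh N hN
    rw [mul_comm y]
    push_cast
    field_simp
  -- Measurability of `f` is not assumed; it is inherited here from the step functions `g N` through
  -- the almost everywhere limit.
  have hg₀m : AEStronglyMeasurable g₀ (volume.restrict (Ioc 0 1)) := by
    refine (aemeasurable_of_tendsto_metrizable_ae' (fun N => (hgm N).aemeasurable)
      ((ae_restrict_iff' measurableSet_Ioc).2 ?_)).aestronglyMeasurable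
    rwa [uIoc_of_le zero_le_one] at hlim
  have hg₀i : IntervalIntegrable g₀ volume 0 1 := by
    rw [intervalIntegrable_iff_integrableOn_Ioc_of_le zero_le_one]
    exact Integrable.of_bound hg₀m M ((ae_restrict_iff' measurableSet_Ioc).2
      (Eventually.of_forall fun y hy => hg₀M y (Ioc_subset_Icc_self hy)))
  have hD : Tendsto (fun N => ∫ y in (0 : ℝ)..1, |g N y - g₀ y|) atTop (𝓝 0) := by
    have h := intervalIntegral.tendsto_integral_filter_of_dominated_convergence (μ := volume)
      (a := 0) (b := 1) (l := atTop) (F := fun N y => |g N y - g₀ y|) (f := fun _ => (0 : ℝ))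
      (fun _ => M + M)
      (Eventually.of_forall fun N => ((hgm N).aestronglyMeasurable.sub
        (by rwa [uIoc_of_le zero_le_one])).norm)
      (hev.mono fun N hN => Eventually.of_forall fun y hy => ?_) (by simp)
      (hlim.mono fun y hy hy01 => ?_)
    · simpa using h
    · rw [uIoc_of_le zero_le_one] at hy
      have hy' := Ioc_subset_Icc_self hy
      rw [Real.norm_eq_abs, abs_abs]
      exact (abs_sub _ _).trans (add_le_add (hgM N hN y hy') (hg₀M y hy'))
    · simpa using ((hy hy01).sub_const (g₀ y)).abs
  -- The three terms are the `L¹` distance of the integrands, the error of the scale, and the last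
  -- incomplete cell of length at most `1 / N`. None depends on `r`.
  refine ⟨fun N => (ζ + 1) * (∫ y in (0 : ℝ)..1, |g N y - g₀ y|) + |N / h N - ζ| * M +
    ζ * M * (1 / N), ?_, hg₀i, ?_⟩
  · have h1 := (hD.const_mul (ζ + 1)).add (((hNh.sub_const ζ).abs).mul_const M)
    have h2 := h1.add ((tendsto_one_div_atTop_nhds_zero_nat (𝕜 := ℝ)).const_mul (ζ * M))
    simpa using h2
  · filter_upwards [hev] with N hN r hr
    have hN0 : (0 : ℝ) < N := by exact_mod_cast hN.1
    have hh0 := hh N hN.1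
    have h0 : (0 : ℝ) ∈ Icc (0 : ℝ) 1 := ⟨le_rfl, zero_le_one⟩
    have hM0 : 0 ≤ M := (abs_nonneg _).trans (hg₀M 0 h0)
    set n := ⌊(N : ℝ) * r⌋₊ with hn
    have hns : (n : ℝ) ≤ N * r := Nat.floor_le (by have := hr.1; positivity)
    have hns' : N * r < n + 1 := Nat.lt_floor_add_one _
    have hle : (n : ℝ) / N ≤ r := (div_le_iff₀' hN0).2 hns
    have hle' : r - (n : ℝ) / N ≤ 1 / N := by
      rw [sub_le_iff_le_add, ← add_div, le_div_iff₀' hN0]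
      linarith
    have hnm : (n : ℝ) / N ∈ Icc (0 : ℝ) 1 := ⟨by positivity, hle.trans hr.2⟩
    have hgi : IntervalIntegrable (g N) volume 0 1 :=
      intervalIntegrable_of_abs_le (hgm N) fun y hy => hgM N hN y (by
        rw [uIoc_of_le zero_le_one] at hy
        exact Ioc_subset_Icc_self hy)
    have hsum : (h N)⁻¹ * ∑ k ∈ Finset.Icc 1 n, f (((k : ℝ) - q N) / h N) =
        N / h N * ∫ y in (0 : ℝ)..(n / N), g N y := by
      rw [integral_comp_floor_mul hN.1 (fun k => f (((k + 1 : ℕ) - q N) / h N)),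
        Finset.range_eq_Ico, Finset.sum_Ico_add' (fun k : ℕ => f (((k : ℕ) - q N) / h N)), zero_add,
        show Finset.Ico 1 (n + 1) = Finset.Icc 1 n from rfl]
      field_simp
    have hint : ∫ t in 0..(ζ * r), f (t - ζ * θ) = ζ * ∫ y in 0..r, g₀ y := by
      have := intervalIntegral.smul_integral_comp_mul_left (a := 0) (b := r)
        (fun t => f (t - ζ * θ)) ζ
      rw [mul_zero, smul_eq_mul] at this
      exact this.symm
    have hdecomp : N / h N * (∫ y in (0 : ℝ)..(n / N), g N y) - ζ * ∫ y in 0..r, g₀ y =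
        N / h N * (∫ y in (0 : ℝ)..(n / N), (g N y - g₀ y)) +
          (N / h N - ζ) * (∫ y in (0 : ℝ)..(n / N), g₀ y) - ζ * ∫ y in (n / N : ℝ)..r, g₀ y := by
      rw [intervalIntegral.integral_sub (hgi.mono_zero_one h0 hnm) (hg₀i.mono_zero_one h0 hnm),
        ← intervalIntegral.integral_add_adjacent_intervals (hg₀i.mono_zero_one h0 hnm)
          (hg₀i.mono_zero_one hnm hr)]
      ring
    have e1 : |∫ y in (0 : ℝ)..(n / N), (g N y - g₀ y)| ≤ ∫ y in (0 : ℝ)..1, |g N y - g₀ y| :=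
      (intervalIntegral.abs_integral_le_integral_abs hnm.1).trans
        (intervalIntegral.integral_mono_interval le_rfl hnm.1 hnm.2
          (Eventually.of_forall fun y => abs_nonneg _) (hgi.sub hg₀i).abs)
    have e2 : ‖∫ y in (0 : ℝ)..(n / N), g₀ y‖ ≤ M * |(n / N : ℝ) - 0| :=
      intervalIntegral.norm_integral_le_of_norm_le_const fun y hy =>
        hg₀M y (uIcc_subset_Icc h0 hnm (uIoc_subset_uIcc hy))
    have e3 : ‖∫ y in (n / N : ℝ)..r, g₀ y‖ ≤ M * |r - n / N| :=
      intervalIntegral.norm_integral_le_of_norm_le_const fun y hy =>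
        hg₀M y (uIcc_subset_Icc hnm hr (uIoc_subset_uIcc hy))
    have e2' : |∫ y in (0 : ℝ)..(n / N), g₀ y| ≤ M := by
      refine e2.trans (mul_le_of_le_one_right hM0 ?_)
      rw [sub_zero, abs_of_nonneg hnm.1]
      exact hnm.2
    have e3' : |∫ y in (n / N : ℝ)..r, g₀ y| ≤ M * (1 / N) := by
      refine e3.trans (mul_le_mul_of_nonneg_left ?_ hM0)
      rwa [abs_of_nonneg (sub_nonneg.2 hle)]
    rw [hsum, hint, hdecomp]
    refine (abs_sub _ _).trans (add_le_add ((abs_add_le _ _).trans (add_le_add ?_ ?_)) ?_)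
    · rw [abs_mul, abs_of_pos (div_pos hN0 hh0)]
      exact mul_le_mul hN.2.1 e1 (abs_nonneg _) (by positivity)
    · rw [abs_mul]
      exact mul_le_mul_of_nonneg_left e2' (abs_nonneg _)
    · rw [abs_mul, abs_of_pos hζ, mul_assoc]
      exact mul_le_mul_of_nonneg_left e3' hζ.le

end PiecewiseContinuous

/-! ### The random walk and the pathwise approximation of its smoother -/

theorem ChangePointModel.tendsto_time_div (cp : ChangePointModel) :
    Tendsto (fun N : ℕ => (cp.time N : ℝ) / N) atTop (𝓝 cp.fraction) := by
  cases cp with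
  | CP1 q => exact tendsto_const_div_atTop_nhds_zero_nat (q : ℝ)
  | CP2 ϑ pos lt_one =>
    refine ((tendsto_nat_floor_mul_div_atTop pos.le).comp tendsto_natCast_atTop_atTop).congr
      fun N => ?_
    simp only [Function.comp_apply, ChangePointModel.time, mul_comm]

theorem IsRandomWalkWithLocalDrift.eq_add_sum {Ω : Type*} {cp : ChangePointModel} {m₀ : ℝ → ℝ}
    {h : ℕ → ℝ} {β : ℝ} {u : ℕ → Ω → ℝ} {Y₁ : Ω → ℝ} {Y : ℕ → ℕ → Ω → ℝ}
    (hY : IsRandomWalkWithLocalDrift cp m₀ h β u Y₁ Y) {N n : ℕ} (hn : n ≤ N) (ω : Ω) :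
    Y N (n + 1) ω = Y₁ ω + ∑ k ∈ Finset.Icc 1 n, localDrift cp m₀ h β N k +
      ∑ k ∈ Finset.Icc 1 n, u k ω := by
  induction n with
  | zero => simp [hY.init]
  | succ n ih =>
    rw [hY.step N (n + 1) ω (by omega) hn, ih (by omega), Finset.sum_Icc_succ_top (by omega),
      Finset.sum_Icc_succ_top (by omega)]
    ring

/-- The partial sum process `N^{-1/2} ∑_{i ≤ ⌊N r⌋} v i` of a sequence. -/
noncomputable def partialSumPath (N : ℕ) (v : ℕ → ℝ) (r : ℝ) : ℝ :=
  (√(N : ℝ))⁻¹ * ∑ i ∈ Finset.Icc 1 ⌊(N : ℝ) * r⌋₊, v i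

theorem measurable_partialSumPath (N : ℕ) (v : ℕ → ℝ) : Measurable (partialSumPath N v) :=
  Nat.measurable_comp_floor_mul (fun n => (√(N : ℝ))⁻¹ * ∑ i ∈ Finset.Icc 1 n, v i) N

theorem limitDrift_eq (cp : ChangePointModel) (K m₀ : ℝ → ℝ) (ζ s : ℝ) :
    limitDrift cp K m₀ ζ s = (ζ ^ (3 / 2 : ℝ))⁻¹ *
      (kernelIntegral K ζ (fun r => ∫ t in 0..(ζ * r), m₀ (t - ζ * cp.fraction)) s /
        kernelIntegral K ζ (fun _ => 1) s) := by
  rw [limitDrift, kernelIntegral_one_eq, kernelIntegral, mul_comm (ζ ^ (3 / 2 : ℝ)), ← div_div,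
    div_eq_inv_mul _ (ζ ^ (3 / 2 : ℝ))]

theorem continuousOn_integral_comp_mul {f : ℝ → ℝ} {ζ θ : ℝ}
    (hf : IntervalIntegrable (fun y => f (ζ * y - θ)) volume 0 1) :
    ContinuousOn (fun r => ∫ t in 0..(ζ * r), f (t - θ)) (Icc 0 1) := by
  have h : (fun r => ∫ t in 0..(ζ * r), f (t - θ)) = fun r => ζ * ∫ y in 0..r, f (ζ * y - θ) := by
    funext r
    have := intervalIntegral.smul_integral_comp_mul_left (a := 0) (b := r) (fun t => f (t - θ)) ζ
    rw [mul_zero, smul_eq_mul] at this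
    exact this.symm
  rw [h]
  have := intervalIntegral.continuousOn_primitive_interval' hf left_mem_uIcc
  rw [uIcc_of_le zero_le_one] at this
  exact this.const_mul ζ

section Smoother

variable {K m₀ : ℝ → ℝ} {h : ℕ → ℝ} {ζ a : ℝ}

theorem AssumptionK.exists_nonneg_lipschitz (hK : AssumptionK K) :
    ∃ L, 0 ≤ L ∧ ∀ z w, |K z - K w| ≤ L * |z - w| := by
  obtain ⟨L, hL⟩ := hK.lipschitz
  refine ⟨L, ?_, hL⟩
  have := (abs_nonneg _).trans (hL 1 0)
  simpa using this

theorem tendsto_inv_bandwidth (hNh : Tendsto (fun N : ℕ => (N : ℝ) / h N) atTop (𝓝 ζ)) :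
    Tendsto (fun N => 2 / h N) atTop (𝓝 0) := by
  have h1 := (hNh.mul (tendsto_const_div_atTop_nhds_zero_nat (2 : ℝ)))
  rw [mul_zero] at h1
  refine h1.congr' ?_
  filter_upwards [eventually_ge_atTop 1] with N hN
  have : (N : ℝ) ≠ 0 := by positivity
  field_simp

theorem tendsto_inv_sqrt_natCast : Tendsto (fun N : ℕ => (√(N : ℝ))⁻¹) atTop (𝓝 0) :=
  tendsto_inv_atTop_zero.comp (Real.tendsto_sqrt_atTop.comp tendsto_natCast_atTop_atTop)

theorem continuousOn_limitDrift (hK : AssumptionK K) (hM : IsGenericAlternative m₀)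
    (hh : ∀ N, 1 ≤ N → 0 < h N) (hζ : 0 < ζ)
    (hNh : Tendsto (fun N : ℕ => (N : ℝ) / h N) atTop (𝓝 ζ)) (cp : ChangePointModel)
    (ha₀ : 0 ≤ a) (hden : ∀ s ∈ Icc a 1, kernelIntegral K ζ (fun _ => 1) s ≠ 0) :
    ContinuousOn (limitDrift cp K m₀ ζ) (Icc a 1) := by
  obtain ⟨L, hL0, hL⟩ := hK.exists_nonneg_lipschitz
  obtain ⟨-, -, hgi, -⟩ :=
    hM.piecewiseContinuous.exists_riemannSum_sub_integral_le hζ hh hNh cp.tendsto_time_div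
  have hG := continuousOn_integral_comp_mul hgi
  obtain ⟨M', hM'⟩ := isCompact_Icc.exists_bound_of_continuousOn hG
  have hsub : Icc a 1 ⊆ Icc (0 : ℝ) 1 := Icc_subset_Icc_left ha₀
  have h1 := (continuousOn_kernelIntegral hL hL0 hζ.le
    (hG.intervalIntegrable_of_Icc zero_le_one) hM').mono hsub
  have h2 := (continuousOn_kernelIntegral (F := fun _ => 1) (M := 1) hL hL0 hζ.le (by simp)
    (by simp)).mono hsub
  exact ((h1.div h2 hden).const_mul _).congr fun s _ => limitDrift_eq cp K m₀ ζ s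

/-- Along every path, the rescaled sequential smoother is close to a deterministic functional of
the partial sum process of the innovations. -/
theorem exists_smoother_sub_le (hK : AssumptionK K) (hM : IsGenericAlternative m₀)
    (hh : ∀ N, 1 ≤ N → 0 < h N) (hζ : 0 < ζ)
    (hNh : Tendsto (fun N : ℕ => (N : ℝ) / h N) atTop (𝓝 ζ)) (cp : ChangePointModel)
    (ha₀ : 0 ≤ a) (hden : ∀ s ∈ Icc a 1, kernelIntegral K ζ (fun _ => 1) s ≠ 0)
    {β b : ℝ} {c : ℕ → ℝ} (hcb : Tendsto (fun N : ℕ => c N * √(N : ℝ)) atTop (𝓝 b))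
    (hcd : Tendsto (fun N : ℕ => c N * h N ^ β * h N) atTop (𝓝 (ζ ^ (3 / 2 : ℝ))⁻¹)) :
    ∃ e : ℕ → ℝ, Tendsto e atTop (𝓝 0) ∧ ∀ᶠ N in atTop, ∀ {Ω : Type*} (u : ℕ → Ω → ℝ)
      (Y₁ : Ω → ℝ) (Y : ℕ → ℕ → Ω → ℝ), IsRandomWalkWithLocalDrift cp m₀ h β u Y₁ Y →
      ∀ (ω : Ω) (T : ℝ), (∀ r ∈ Icc (0 : ℝ) 1, |partialSumPath N (fun i => u i ω) r| ≤ T) →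
      ∀ s ∈ Icc a 1, |c N * sequentialSmoother K h Y N s ω -
        (b * (kernelIntegral K ζ (partialSumPath N fun i => u i ω) s /
          kernelIntegral K ζ (fun _ => 1) s) + limitDrift cp K m₀ ζ s)| ≤
        e N * (1 + T + |Y₁ ω|) := by
  obtain ⟨L, hL0, hL⟩ := hK.exists_nonneg_lipschitz
  have hKc := continuous_of_abs_sub_le hL
  obtain ⟨ε, hε, hgi, hdrift⟩ :=
    hM.piecewiseContinuous.exists_riemannSum_sub_integral_le hζ hh hNh cp.tendsto_time_div
  obtain ⟨d, hd, hds⟩ := exists_pos_le_kernelIntegral_one hL hL0 hK.nonneg hζ.le ha₀ hden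
  have hGc := continuousOn_integral_comp_mul hgi
  set G : ℝ → ℝ := fun r => ∫ t in 0..(ζ * r), m₀ (t - ζ * cp.fraction) with hG
  obtain ⟨MG, hMG⟩ := isCompact_Icc.exists_bound_of_continuousOn hGc
  have hMG0 : 0 ≤ MG := (norm_nonneg _).trans (hMG 0 ⟨le_rfl, zero_le_one⟩)
  have hGi : IntervalIntegrable G volume 0 1 := hGc.intervalIntegrable_of_Icc zero_le_one
  set z : ℝ := (ζ ^ (3 / 2 : ℝ))⁻¹ with hz
  have hz0 : 0 ≤ z := by positivity
  let η : ℕ → ℝ := fun N => L * (2 / h N + |N / h N - ζ|) + (|K 0| + L * ζ) / N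
  have hη : Tendsto η atTop (𝓝 0) := by
    have h1 := ((tendsto_inv_bandwidth hNh).add (hNh.sub_const ζ).abs).const_mul L
    have h2 := h1.add (tendsto_const_div_atTop_nhds_zero_nat (|K 0| + L * ζ))
    simpa using h2
  let w : ℕ → ℝ := fun N => c N * h N ^ β * h N
  -- As `c N * √N` converges, `c` itself vanishes, and with it the contribution of `Y₁`.
  have hc : Tendsto c atTop (𝓝 0) := by
    have h1 := hcb.mul tendsto_inv_sqrt_natCast
    rw [mul_zero] at h1
    refine h1.congr' ?_
    filter_upwards [eventually_ge_atTop 1] with N hN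
    have : √(N : ℝ) ≠ 0 := by positivity
    field_simp
  -- Relative to `1 + T + |Y₁ ω|`, `B` bounds the rescaled walk and `ρ` its distance from `b S + z
  -- G`. Since `B` converges, multiplying it by the Riemann sum error `η` still gives zero in the
  -- limit.
  let B : ℕ → ℝ := fun N => |c N| + |w N| * (MG + ε N) + |c N * √(N : ℝ)|
  let ρ : ℕ → ℝ := fun N => |c N| + |c N * √(N : ℝ) - b| + (|w N| * ε N + |w N - z| * MG)
  have hB : Tendsto B atTop (𝓝 (|0| + |z| * (MG + 0) + |b|)) :=
    (hc.abs.add (hcd.abs.mul (hε.const_add MG))).add hcb.abs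
  have hρ : Tendsto ρ atTop (𝓝 0) := by
    have h1 := (hc.abs.add (hcb.sub_const b).abs).add
      ((hcd.abs.mul hε).add ((hcd.sub_const z).abs.mul_const MG))
    simp only [sub_self, abs_zero, mul_zero, zero_mul, add_zero] at h1
    exact h1
  refine ⟨fun N => 4 * η N / d * B N + ρ N, ?_, ?_⟩
  · have h1 := (((hη.const_mul 4).div_const d).mul hB).add hρ
    simpa using h1
  filter_upwards [hdrift, eventually_ge_atTop 1, hη.eventually (eventually_le_nhds (half_pos hd))]
    with N hdriftN hN hηN Ω u Y₁ Y hY ω T hT s hs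
  have hN0 : (0 : ℝ) < N := by exact_mod_cast hN
  have hsq : √(N : ℝ) ≠ 0 := by positivity
  have hh0 := hh N hN
  have hs01 : s ∈ Icc (0 : ℝ) 1 := ⟨ha₀.trans hs.1, hs.2⟩
  have hT0 : 0 ≤ T := (abs_nonneg _).trans (hT 0 ⟨le_rfl, zero_le_one⟩)
  have hε0 : 0 ≤ ε N := (abs_nonneg _).trans (hdriftN 0 ⟨le_rfl, zero_le_one⟩)
  set S : ℝ → ℝ := partialSumPath N fun i => u i ω with hS
  let A : ℝ → ℝ := fun r => (h N)⁻¹ * ∑ k ∈ Finset.Icc 1 ⌊(N : ℝ) * r⌋₊,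
    m₀ (((k : ℝ) - cp.time N) / h N)
  let x : ℕ → ℝ := fun i => c N * Y N i ω
  have hxr : ∀ r ∈ Icc (0 : ℝ) 1, x (⌊(N : ℝ) * r⌋₊ + 1) =
      c N * Y₁ ω + w N * A r + c N * √(N : ℝ) * S r := by
    intro r hr
    simp only [x, w, A, hS, partialSumPath]
    rw [hY.eq_add_sum (Nat.floor_natCast_mul_le hr.2)]
    simp only [localDrift, ← Finset.sum_mul]
    field_simp
  have hAle : ∀ r ∈ Icc (0 : ℝ) 1, |A r| ≤ MG + ε N := fun r hr => by
    have h1 := hdriftN r hr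
    have h2 := abs_sub_abs_le_abs_sub (A r) (G r)
    have h3 := hMG r hr
    rw [Real.norm_eq_abs] at h3
    linarith
  have hxF : ∀ r ∈ Icc (0 : ℝ) 1, |x (⌊(N : ℝ) * r⌋₊ + 1)| ≤ B N * (1 + T + |Y₁ ω|) := by
    intro r hr
    rw [hxr r hr]
    calc |c N * Y₁ ω + w N * A r + c N * √(N : ℝ) * S r|
        ≤ |c N| * |Y₁ ω| + |w N| * |A r| + |c N * √(N : ℝ)| * |S r| := by
          rw [← abs_mul, ← abs_mul, ← abs_mul]
          exact abs_add_three _ _ _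
      _ ≤ |c N| * (1 + T + |Y₁ ω|) + |w N| * (MG + ε N) * (1 + T + |Y₁ ω|) +
          |c N * √(N : ℝ)| * (1 + T + |Y₁ ω|) := by
          refine add_le_add (add_le_add ?_ ?_) ?_
          · exact mul_le_mul_of_nonneg_left (by linarith) (abs_nonneg _)
          · refine (mul_le_mul_of_nonneg_left (hAle r hr) (abs_nonneg _)).trans ?_
            exact le_mul_of_one_le_right (by positivity) (by linarith [abs_nonneg (Y₁ ω)])
          · exact mul_le_mul_of_nonneg_left
              ((hT r hr).trans (by linarith [abs_nonneg (Y₁ ω)])) (abs_nonneg _)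
      _ = _ := by simp only [B]; ring
  -- Every such index has the form `⌊N r⌋ + 1` with `r = (i - 1) / N` in `[0,1]`.
  have hx : ∀ i, 1 ≤ i → i ≤ N + 1 → |x i| ≤ B N * (1 + T + |Y₁ ω|) := by
    intro i hi hi'
    obtain ⟨n, rfl⟩ : ∃ n, i = n + 1 := ⟨i - 1, by omega⟩
    have hn : (n : ℝ) ≤ N := by exact_mod_cast (by omega : n ≤ N)
    have := hxF (n / N) ⟨by positivity, (div_le_one hN0).2 hn⟩
    rwa [mul_div_cancel₀ _ hN0.ne', Nat.floor_natCast] at this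
  have havg := abs_weightedAverage_sub_le hL hL0 hK.nonneg hζ.le hN hh0 x hx hs01 hd (hds s hs) hηN
  have hsm : c N * sequentialSmoother K h Y N s ω =
      (∑ i ∈ Finset.Icc 1 ⌊(N : ℝ) * s⌋₊,
        rescaledKernel K (h N) ((i : ℝ) - (⌊(N : ℝ) * s⌋₊ : ℝ)) * x i) /
        (∑ i ∈ Finset.Icc 1 ⌊(N : ℝ) * s⌋₊,
          rescaledKernel K (h N) ((i : ℝ) - (⌊(N : ℝ) * s⌋₊ : ℝ))) := by
    rw [sequentialSmoother, ← mul_div_assoc, Finset.mul_sum]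
    simp only [x, mul_left_comm]
  have hSi : IntervalIntegrable S volume 0 1 :=
    intervalIntegrable_of_abs_le (measurable_partialSumPath _ _) fun r hr => hT r (by
      rw [uIoc_of_le zero_le_one] at hr
      exact Ioc_subset_Icc_self hr)
  have hxi : IntervalIntegrable (fun r => x (⌊(N : ℝ) * r⌋₊ + 1)) volume 0 1 :=
    intervalIntegrable_of_abs_le (Nat.measurable_comp_floor_mul (fun i => x (i + 1)) N)
      fun r hr => hxF r (by
        rw [uIoc_of_le zero_le_one] at hr
        exact Ioc_subset_Icc_self hr)
  have hlin : kernelIntegral K ζ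
      (fun r => x (⌊(N : ℝ) * r⌋₊ + 1) - (b * S r + z * G r)) s =
      kernelIntegral K ζ (fun r => x (⌊(N : ℝ) * r⌋₊ + 1)) s -
        (b * kernelIntegral K ζ S s + z * kernelIntegral K ζ G s) := by
    rw [kernelIntegral_sub hKc ζ hxi ((hSi.const_mul b).add (hGi.const_mul z)) hs01,
      kernelIntegral_add hKc ζ (hSi.const_mul b) (hGi.const_mul z) hs01,
      kernelIntegral_const_mul K ζ b S, kernelIntegral_const_mul K ζ z G]
  have hq0 : 0 < kernelIntegral K ζ (fun _ => 1) s := hd.trans_le (hds s hs)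
  have hres : |kernelIntegral K ζ (fun r => x (⌊(N : ℝ) * r⌋₊ + 1)) s /
      kernelIntegral K ζ (fun _ => 1) s - (b * (kernelIntegral K ζ S s /
          kernelIntegral K ζ (fun _ => 1) s) + limitDrift cp K m₀ ζ s)| ≤
      ρ N * (1 + T + |Y₁ ω|) := by
    have heq : kernelIntegral K ζ (fun r => x (⌊(N : ℝ) * r⌋₊ + 1)) s /
        kernelIntegral K ζ (fun _ => 1) s - (b * (kernelIntegral K ζ S s /
          kernelIntegral K ζ (fun _ => 1) s) + limitDrift cp K m₀ ζ s) =
        kernelIntegral K ζ (fun r => x (⌊(N : ℝ) * r⌋₊ + 1) - (b * S r + z * G r)) s /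
          kernelIntegral K ζ (fun _ => 1) s := by
      rw [hlin, limitDrift_eq]
      ring
    rw [heq, abs_div, abs_of_pos hq0, div_le_iff₀ hq0]
    refine abs_kernelIntegral_le_mul hKc hK.nonneg ζ hs01 fun r hr => ?_
    have heq2 : x (⌊(N : ℝ) * r⌋₊ + 1) - (b * S r + z * G r) =
        c N * Y₁ ω + (c N * √(N : ℝ) - b) * S r + (w N * (A r - G r) + (w N - z) * G r) := by
      rw [hxr r hr]
      ring
    rw [heq2]
    calc |c N * Y₁ ω + (c N * √(N : ℝ) - b) * S r + (w N * (A r - G r) + (w N - z) * G r)|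
        ≤ |c N| * |Y₁ ω| + |c N * √(N : ℝ) - b| * |S r| +
          (|w N| * |A r - G r| + |w N - z| * |G r|) := by
          rw [← abs_mul, ← abs_mul, ← abs_mul, ← abs_mul]
          exact (abs_add_three _ _ _).trans (add_le_add le_rfl (abs_add_le _ _))
      _ ≤ |c N| * (1 + T + |Y₁ ω|) + |c N * √(N : ℝ) - b| * (1 + T + |Y₁ ω|) +
          (|w N| * ε N + |w N - z| * MG) * (1 + T + |Y₁ ω|) := by
          refine add_le_add (add_le_add ?_ ?_) ?_
          · exact mul_le_mul_of_nonneg_left (by linarith) (abs_nonneg _)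
          · exact mul_le_mul_of_nonneg_left
              ((hT r hr).trans (by linarith [abs_nonneg (Y₁ ω)])) (abs_nonneg _)
          · refine le_trans (add_le_add (mul_le_mul_of_nonneg_left (hdriftN r hr) (abs_nonneg _))
              (mul_le_mul_of_nonneg_left (hMG r hr) (abs_nonneg _))) ?_
            exact le_mul_of_one_le_right (by positivity) (by linarith [abs_nonneg (Y₁ ω)])
      _ = _ := by simp only [ρ]; ring
  rw [hsm]
  refine (abs_sub_le _ _ _).trans ((add_le_add havg hres).trans (le_of_eq ?_))
  simp only [η]
  ring

end Smoother

/-! ### Random step functions and continuity of smoothing -/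

namespace SkorokhodSpace

variable {a b : ℝ}

/-- Near `x` the integer floor is constant on each side: `⌊x⌋` from the right and `⌈x⌉ - 1` strictly
from the left. So any function of it has both one-sided limits. -/
theorem _root_.isCadlag_comp_floor_mul (N : ℕ) (v : ℕ → ℝ) :
    IsCadlag fun t : Icc a b => v ⌊(N : ℝ) * t⌋₊ := by
  rcases N.eq_zero_or_pos with rfl | hN
  · simpa using IsCadlag.of_continuous (a := a) (b := b) (f := fun _ => v 0) continuous_const
  have hN0 : (0 : ℝ) < N := Nat.cast_pos.2 hN
  have hcont : Continuous fun t : Icc a b => (N : ℝ) * t := by fun_prop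
  have hpure : ∀ z : ℤ, Tendsto (fun z : ℤ => v z.toNat) (pure z) (𝓝 (v z.toNat)) := fun z =>
    tendsto_pure_left.2 fun _ hs => mem_of_mem_nhds hs
  simp only [← Int.floor_toNat]
  intro t
  constructor
  · refine (hpure _).comp ((tendsto_floor_right_pure_floor _).comp
      (tendsto_nhdsWithin_of_tendsto_nhds_of_eventually_within _
        hcont.continuousAt.continuousWithinAt.tendsto ?_))
    filter_upwards [self_mem_nhdsWithin] with s hs
    exact mul_le_mul_of_nonneg_left (show (t : ℝ) ≤ s from hs) hN0.le
  · refine ⟨_, (hpure _).comp ((tendsto_floor_left_pure_ceil_sub_one ((N : ℝ) * t)).comp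
      (tendsto_nhdsWithin_of_tendsto_nhds_of_eventually_within _
        hcont.continuousAt.continuousWithinAt.tendsto ?_))⟩
    filter_upwards [self_mem_nhdsWithin] with s hs
    exact mul_lt_mul_of_pos_left (show (s : ℝ) < t from hs) hN0

/-- The step function `t ↦ v ⌊N t⌋`. -/
noncomputable def step (N : ℕ) (v : ℕ → ℝ) : SkorokhodSpace a b :=
  ⟨fun t => v ⌊(N : ℝ) * t⌋₊, isCadlag_comp_floor_mul N v⟩

/-- The path on `[a,1]` depends only on `v 0, …, v N`, and does so in a 1-Lipschitz way from the sup
norm to the Skorokhod distance. Borel measurability thus reduces to finitely many coordinates. -/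
theorem aemeasurable_step {Ω : Type*} [MeasurableSpace Ω] {P : Measure Ω} {N : ℕ}
    {v : Ω → ℕ → ℝ} (hv : ∀ n ≤ N, AEMeasurable (fun ω => v ω n) P) :
    AEMeasurable (fun ω => (step N (v ω) : SkorokhodSpace a 1)) P := by
  let J : (Fin (N + 1) → ℝ) → SkorokhodSpace a 1 := fun w =>
    step N fun n => w (Fin.ofNat (N + 1) n)
  have hJ : LipschitzWith 1 J := fun w w' => by
    rw [ENNReal.coe_one, one_mul]
    exact (edist_le_iSup_edist _ _).trans (iSup_le fun t => edist_le_pi_edist w w' _)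
  have heq : (fun ω => (step N (v ω) : SkorokhodSpace a 1)) =
      J ∘ fun ω (i : Fin (N + 1)) => v ω i := by
    funext ω
    refine Subtype.ext (funext fun t => ?_)
    have : ⌊(N : ℝ) * t⌋₊ ≤ N := Nat.floor_natCast_mul_le t.2.2
    change v ω ⌊(N : ℝ) * t⌋₊ = v ω (⌊(N : ℝ) * t⌋₊ % (N + 1))
    rw [Nat.mod_eq_of_lt (by omega)]
  rw [heq]
  exact hJ.continuous.measurable.comp_aemeasurable
    (aemeasurable_pi_iff.2 fun i => hv i (Nat.lt_succ_iff.1 i.2))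

/-- The extension of an element of `D[0,1]` to the real line. -/
noncomputable def extend (f : SkorokhodSpace 0 1) (r : ℝ) : ℝ := f (projIcc 0 1 zero_le_one r)

theorem extend_of_mem (f : SkorokhodSpace 0 1) {r : ℝ} (hr : r ∈ Icc (0 : ℝ) 1) :
    extend f r = f ⟨r, hr⟩ := by
  rw [extend, projIcc_of_mem zero_le_one hr]

theorem measurable_extend (f : SkorokhodSpace 0 1) : Measurable (extend f) :=
  f.2.measurable.comp continuous_projIcc.measurable

theorem abs_extend_le (f : SkorokhodSpace 0 1) (r : ℝ) : |extend f r| ≤ (supENorm f).toReal :=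
  abs_le_toReal_supENorm f _

theorem intervalIntegrable_extend (f : SkorokhodSpace 0 1) :
    IntervalIntegrable (extend f) volume 0 1 :=
  intervalIntegrable_of_abs_le (measurable_extend f) fun r _ => abs_extend_le f r

/-- Paths converge off the countable set of jumps of `g`, and their sup norms are eventually bounded
by that of `g` plus one, so dominated convergence applies. -/
theorem tendsto_integral_abs_extend_sub {f : ℕ → SkorokhodSpace 0 1} {g : SkorokhodSpace 0 1}
    (hfg : Tendsto f atTop (𝓝 g)) :
    Tendsto (fun n => ∫ r in (0 : ℝ)..1, |extend (f n) r - extend g r|) atTop (𝓝 0) := by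
  have hsup : ∀ᶠ n in atTop, (supENorm (f n)).toReal ≤ (supENorm g).toReal + 1 := by
    filter_upwards [EMetric.tendsto_nhds.1 hfg 1 one_pos] with n hn
    rw [edist_comm] at hn
    have h1 : supENorm (f n) ≤ supENorm g + 1 :=
      (supENorm_le_add_edist g (f n)).trans (add_le_add le_rfl hn.le)
    have h2 := ENNReal.toReal_mono (ENNReal.add_lt_top.2 ⟨supENorm_lt_top g, ENNReal.one_lt_top⟩).ne
      h1
    rwa [ENNReal.toReal_add (supENorm_lt_top g).ne ENNReal.one_ne_top, ENNReal.toReal_one] at h2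
  have hlim : ∀ᵐ r : ℝ, r ∈ uIoc (0 : ℝ) 1 →
      Tendsto (fun n => |extend (f n) r - extend g r|) atTop (𝓝 0) := by
    filter_upwards [(g.2.countable_not_continuousAt.image Subtype.val).ae_notMem volume]
      with r hr hr01
    rw [uIoc_of_le zero_le_one] at hr01
    have hr' := Ioc_subset_Icc_self hr01
    have hc : ContinuousAt g ⟨r, hr'⟩ := by
      by_contra hnot
      exact hr ⟨⟨r, hr'⟩, hnot, rfl⟩
    simp only [extend_of_mem _ hr']
    simpa using ((tendsto_apply hfg hc).sub_const (g ⟨r, hr'⟩)).abs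
  have h := intervalIntegral.tendsto_integral_filter_of_dominated_convergence (μ := volume)
    (a := 0) (b := 1) (l := atTop) (F := fun n r => |extend (f n) r - extend g r|)
    (f := fun _ => (0 : ℝ)) (fun _ => (supENorm g).toReal + 1 + (supENorm g).toReal)
    (Eventually.of_forall fun n =>
      ((measurable_extend (f n)).sub (measurable_extend g)).abs.aestronglyMeasurable)
    (hsup.mono fun n hn => Eventually.of_forall fun r _ => ?_) (by simp) hlim
  · simpa using h
  · rw [Real.norm_eq_abs, abs_abs]
    exact (abs_sub _ _).trans (add_le_add ((abs_extend_le _ _).trans hn) (abs_extend_le _ _))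

/-- The normalised smoothing functional with drift `δ`, as a map `D[0,1] → D[a,1]`. -/
noncomputable def smooth {K : ℝ → ℝ} {L ζ : ℝ} (hL : ∀ z w, |K z - K w| ≤ L * |z - w|) (hL0 : 0 ≤ L)
    (hζ : 0 ≤ ζ) (ha₀ : 0 ≤ a) (hden : ∀ s ∈ Icc a 1, kernelIntegral K ζ (fun _ => 1) s ≠ 0)
    {δ : ℝ → ℝ} (hδ : ContinuousOn δ (Icc a 1)) (c : ℝ) (f : SkorokhodSpace 0 1) :
    SkorokhodSpace a 1 :=
  ⟨fun s => c * (kernelIntegral K ζ (extend f) s / kernelIntegral K ζ (fun _ => 1) s) + δ s, by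
    have hsub : Icc a 1 ⊆ Icc (0 : ℝ) 1 := Icc_subset_Icc_left ha₀
    have h1 := (continuousOn_kernelIntegral hL hL0 hζ (intervalIntegrable_extend f)
      fun r _ => abs_extend_le f r).mono hsub
    have h2 := (continuousOn_kernelIntegral (F := fun _ => 1) (M := 1) hL hL0 hζ (by simp)
      (by simp)).mono hsub
    exact IsCadlag.of_continuous
      (continuousOn_iff_continuous_domRestrict.1 (((h1.div h2 hden).const_mul c).add hδ))⟩

theorem continuous_smooth {K : ℝ → ℝ} {L ζ : ℝ} (hL : ∀ z w, |K z - K w| ≤ L * |z - w|)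
    (hL0 : 0 ≤ L) (hK0 : ∀ z, 0 ≤ K z) (hζ : 0 ≤ ζ) (ha₀ : 0 ≤ a)
    (hden : ∀ s ∈ Icc a 1, kernelIntegral K ζ (fun _ => 1) s ≠ 0)
    {δ : ℝ → ℝ} (hδ : ContinuousOn δ (Icc a 1)) (c : ℝ) :
    Continuous (smooth hL hL0 hζ ha₀ hden hδ c) := by
  obtain ⟨d, hd, hds⟩ := exists_pos_le_kernelIntegral_one hL hL0 hK0 hζ ha₀ hden
  refine continuous_iff_seqContinuous.2 fun f g hfg => ?_
  let D : ℕ → ℝ := fun n => ∫ r in (0 : ℝ)..1, |extend (f n) r - extend g r|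
  have hle : ∀ n, edist (smooth hL hL0 hζ ha₀ hden hδ c (f n)) (smooth hL hL0 hζ ha₀ hden hδ c g) ≤
      ENNReal.ofReal (|c| * ((|K 0| + L * ζ) * D n / d)) := by
    intro n
    refine (edist_le_iSup_edist _ _).trans (iSup_le fun s => ?_)
    have hs01 : (s : ℝ) ∈ Icc (0 : ℝ) 1 := ⟨ha₀.trans s.2.1, s.2.2⟩
    have hq := hds s s.2
    rw [edist_dist, Real.dist_eq]
    refine ENNReal.ofReal_le_ofReal ?_
    have heq : smooth hL hL0 hζ ha₀ hden hδ c (f n) s - smooth hL hL0 hζ ha₀ hden hδ c g s =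
        c * (kernelIntegral K ζ (fun r => extend (f n) r - extend g r) s /
          kernelIntegral K ζ (fun _ => 1) s) := by
      rw [kernelIntegral_sub (continuous_of_abs_sub_le hL) ζ (intervalIntegrable_extend _)
        (intervalIntegrable_extend _) hs01]
      simp only [smooth]
      ring
    rw [heq, abs_mul, abs_div, abs_of_pos (hd.trans_le hq)]
    refine mul_le_mul_of_nonneg_left (div_le_div₀ ?_ ?_ hd hq) (abs_nonneg _)
    · exact mul_nonneg (by positivity)
        (intervalIntegral.integral_nonneg zero_le_one fun r _ => abs_nonneg _)
    · exact abs_kernelIntegral_le_integral hL hL0 hζ hs01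
        ((intervalIntegrable_extend _).sub (intervalIntegrable_extend _))
  rw [tendsto_iff_edist_tendsto_0]
  refine tendsto_of_tendsto_of_tendsto_of_le_of_le tendsto_const_nhds ?_ (fun _ => bot_le) hle
  have h1 := (((tendsto_integral_abs_extend_sub hfg).const_mul (|K 0| + L * ζ)).div_const d).const_mul
    |c|
  simpa using ENNReal.tendsto_ofReal h1

end SkorokhodSpace

/-! ### Scaling exponents and the two limit theorems -/

/-- Both regimes share this drift scale: `(α, β)` is `(1, -1/2)` in (i) and `(1/2, 0)` in (ii). -/
theorem rpow_scale_drift {x y : ℝ} (hx : 0 < x) (hy : 0 < y) {α β : ℝ} (hαβ : α + β = 1 / 2) :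
    x ^ α * y ^ (-(3 / 2) : ℝ) * x ^ β * x = (x / y) ^ (3 / 2 : ℝ) := by
  rw [Real.div_rpow hx.le hy.le, Real.rpow_neg hy.le, ← div_eq_mul_inv,
    show (3 / 2 : ℝ) = α + β + 1 by rw [hαβ]; norm_num, Real.rpow_add hx, Real.rpow_add hx,
    Real.rpow_one]
  ring

theorem rpow_neg_three_halves_mul_sqrt {y : ℝ} (hy : 0 < y) : y ^ (-(3 / 2) : ℝ) * √y = y⁻¹ := by
  rw [Real.sqrt_eq_rpow, ← Real.rpow_add hy, ← Real.rpow_neg_one]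
  norm_num

theorem IsRandomWalkWithLocalDrift.aemeasurable {Ω : Type*} [MeasurableSpace Ω] {P : Measure Ω}
    {cp : ChangePointModel} {m₀ : ℝ → ℝ} {h : ℕ → ℝ} {β : ℝ} {u : ℕ → Ω → ℝ} {Y₁ : Ω → ℝ}
    {Y : ℕ → ℕ → Ω → ℝ} (hY : IsRandomWalkWithLocalDrift cp m₀ h β u Y₁ Y)
    (hu : ∀ n, 1 ≤ n → AEMeasurable (u n) P) (hY₁ : AEMeasurable Y₁ P) {N i : ℕ} (hi : 1 ≤ i)
    (hiN : i ≤ N + 1) : AEMeasurable (Y N i) P := by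
  obtain ⟨n, rfl⟩ : ∃ n, i = n + 1 := ⟨i - 1, by omega⟩
  rw [show Y N (n + 1) = _ from funext fun ω => hY.eq_add_sum (by omega) ω]
  exact (hY₁.add_const _).add
    (Finset.aemeasurable_fun_sum _ fun k hk => hu k (Finset.mem_Icc.1 hk).1)

theorem theorem2 {Ω Ω' : Type*} [MeasurableSpace Ω] [MeasurableSpace Ω']
    (P : Measure Ω) [IsProbabilityMeasure P] (P' : Measure Ω') [IsProbabilityMeasure P']
    (u : ℕ → Ω → ℝ) (σ : ℝ) (B : ℝ≥0 → Ω' → ℝ) (hB : IsBrownianReal B P')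
    (hA : AssumptionA P P' u σ B)
    (K : ℝ → ℝ) (hK : AssumptionK K)
    (m₀ : ℝ → ℝ) (hM : IsGenericAlternative m₀)
    (c : ℝ) (hKM : AssumptionKM K m₀ c)
    (h : ℕ → ℝ) (hh : ∀ N, 1 ≤ N → 0 < h N)
    (ζ : ℝ) (hζ : 1 ≤ ζ) (hNh : Tendsto (fun N : ℕ => (N : ℝ) / h N) atTop (𝓝 ζ))
    (cp : ChangePointModel)
    (Y₁ : Ω → ℝ) (hY₁ : AEMeasurable Y₁ P)
    (a : ℝ) (ha₀ : 0 < a) (ha₁ : a < 1)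
    (hden : ∀ s ∈ Icc a 1, (∫ r in 0..s, K (ζ * (r - s))) ≠ 0) :
    (∀ Y : ℕ → ℕ → Ω → ℝ, IsRandomWalkWithLocalDrift cp m₀ h (-1 / 2) u Y₁ Y →
      WeaklyConvergesInD a 1
        (fun N s ω => h N * (N : ℝ) ^ (-(3 / 2) : ℝ) * sequentialSmoother K h Y N s ω) P
        (fun s ω => nullLimit K ζ σ B s ω + limitDrift cp K m₀ ζ s) P') ∧
    (∀ Y : ℕ → ℕ → Ω → ℝ, IsRandomWalkWithLocalDrift cp m₀ h 0 u Y₁ Y →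
      UniformlyConvergesInProbability (Icc a 1)
        (fun N s ω =>
          h N ^ (1 / 2 : ℝ) * (N : ℝ) ^ (-(3 / 2) : ℝ) * sequentialSmoother K h Y N s ω) P
        (limitDrift cp K m₀ ζ)) := by
  have hζ0 : 0 < ζ := one_pos.trans_le hζ
  obtain ⟨L, hL0, hL⟩ := hK.exists_nonneg_lipschitz
  have hden' : ∀ s ∈ Icc a 1, kernelIntegral K ζ (fun _ => 1) s ≠ 0 := fun s hs => by
    rw [kernelIntegral_one_eq]
    exact hden s hs
  have hδ := continuousOn_limitDrift hK hM hh hζ0 hNh cp ha₀.le hden'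
  have hratio : Tendsto (fun N : ℕ => h N / N) atTop (𝓝 ζ⁻¹) :=
    (hNh.inv₀ hζ0.ne').congr fun N => inv_div _ _
  have hdriftScale : Tendsto (fun N : ℕ => (h N / N) ^ (3 / 2 : ℝ)) atTop
      (𝓝 (ζ ^ (3 / 2 : ℝ))⁻¹) := by
    rw [← Real.inv_rpow hζ0.le]
    exact hratio.rpow_const (Or.inr (by norm_num))
  obtain ⟨X, Z, hX, hZ, hXZ⟩ := hA.functionalCLT
  have hbound : ∀ (N : ℕ) (ω : Ω), (∀ t : Icc (0 : ℝ) 1, X N ω t =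
      (√(N : ℝ))⁻¹ * ∑ i ∈ Finset.Icc 1 ⌊(N : ℝ) * t⌋₊, u i ω) → ∀ r ∈ Icc (0 : ℝ) 1,
      |partialSumPath N (fun i => u i ω) r| ≤ (SkorokhodSpace.supENorm (X N ω)).toReal := by
    intro N ω hω r hr
    have := SkorokhodSpace.abs_le_toReal_supENorm (X N ω) ⟨r, hr⟩
    rwa [hω] at this
  constructor
  · intro Y hY
    obtain ⟨e, he, hev⟩ := exists_smoother_sub_le hK hM hh hζ0 hNh cp ha₀.le hden'
      (β := -1 / 2) (b := ζ⁻¹) (c := fun N => h N * (N : ℝ) ^ (-(3 / 2) : ℝ))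
      (hratio.congr' (by
        filter_upwards [eventually_ge_atTop 1] with N hN
        rw [mul_assoc, rpow_neg_three_halves_mul_sqrt (by exact_mod_cast hN), div_eq_mul_inv]))
      (hdriftScale.congr' (by
        filter_upwards [eventually_ge_atTop 1] with N hN
        rw [← rpow_scale_drift (hh N hN) (by exact_mod_cast hN)
          (show (1 : ℝ) + (-1 / 2) = 1 / 2 by norm_num), Real.rpow_one]))
    let Ψ := SkorokhodSpace.smooth hL hL0 hζ0.le ha₀.le hden' hδ ζ⁻¹
    have hΨ : Continuous Ψ :=
      SkorokhodSpace.continuous_smooth hL hL0 hK.nonneg hζ0.le ha₀.le hden' hδ ζ⁻¹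
    -- The smoother depends on `s` only through `n = ⌊N s⌋`, so its path is a step function; for `n
    -- = 0` the quotient `0 / 0` is zero.
    let v : ℕ → Ω → ℕ → ℝ := fun N ω n => h N * (N : ℝ) ^ (-(3 / 2) : ℝ) *
      ((∑ i ∈ Finset.Icc 1 n, rescaledKernel K (h N) ((i : ℝ) - (n : ℝ)) * Y N i ω) /
        ∑ i ∈ Finset.Icc 1 n, rescaledKernel K (h N) ((i : ℝ) - (n : ℝ)))
    have hv : ∀ N, ∀ n ≤ N, AEMeasurable (fun ω => v N ω n) P := fun N n hn =>
      ((Finset.aemeasurable_fun_sum _ fun i hi => by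
        obtain ⟨hi1, hi2⟩ := Finset.mem_Icc.1 hi
        exact (hY.aemeasurable (fun k hk => (hA.memLp k hk).aestronglyMeasurable.aemeasurable)
          hY₁ hi1 (by omega)).const_mul _).div_const _).const_mul _
    refine ⟨fun N ω => SkorokhodSpace.step N (v N ω), Ψ ∘ Z,
      fun N => Eventually.of_forall fun ω t => rfl, ?_, ?_⟩
    · filter_upwards [hZ] with ω hω s
      have hs01 : (s : ℝ) ∈ Icc (0 : ℝ) 1 := ⟨ha₀.le.trans s.2.1, s.2.2⟩
      have hcongr : kernelIntegral K ζ (SkorokhodSpace.extend (Z ω)) s =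
          σ * kernelIntegral K ζ (fun r => B r.toNNReal ω) s := by
        rw [← kernelIntegral_const_mul]
        exact kernelIntegral_congr hs01 fun r hr => by
          rw [SkorokhodSpace.extend_of_mem _ hr, hω]
      change ζ⁻¹ * (kernelIntegral K ζ (SkorokhodSpace.extend (Z ω)) s /
        kernelIntegral K ζ (fun _ => 1) s) + limitDrift cp K m₀ ζ s = _
      rw [hcongr, nullLimit, ← kernelIntegral_one_eq, kernelIntegral,
        mul_comm ζ (kernelIntegral K ζ _ _), ← div_div, div_eq_inv_mul _ ζ]
    · refine (hXZ.continuous_comp hΨ).of_edist (fun N => SkorokhodSpace.aemeasurable_step (hv N))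
        fun ε hε => ?_
      -- Halving `ε` leaves room for a contradiction: if the error bound is below `ε / 2`, the
      -- Skorokhod distance is at most `ε / 2` and cannot reach `ε`.
      refine tendsto_of_tendsto_of_tendsto_of_le_of_le' tendsto_const_nhds
        (SkorokhodSpace.tendsto_measure_mul_supENorm hXZ hY₁ he (half_pos hε))
        (Eventually.of_forall fun _ => bot_le) ?_
      filter_upwards [hev] with N hevN
      refine measure_mono_ae ?_
      filter_upwards [hX N] with ω hω hmem
      by_contra hnot
      have hlt : e N * (1 + (SkorokhodSpace.supENorm (X N ω)).toReal + |Y₁ ω|) < ε / 2 :=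
        not_le.1 hnot
      have hle : edist (SkorokhodSpace.step N (v N ω) : SkorokhodSpace a 1) (Ψ (X N ω)) ≤
          ENNReal.ofReal (ε / 2) := by
        refine (SkorokhodSpace.edist_le_iSup_edist _ _).trans (iSup_le fun s => ?_)
        have hs01 : (s : ℝ) ∈ Icc (0 : ℝ) 1 := ⟨ha₀.le.trans s.2.1, s.2.2⟩
        have hcongr : kernelIntegral K ζ (SkorokhodSpace.extend (X N ω)) s =
            kernelIntegral K ζ (partialSumPath N fun i => u i ω) s :=
          kernelIntegral_congr hs01 fun r hr => by
            rw [SkorokhodSpace.extend_of_mem _ hr, hω]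
            rfl
        have h1 := (hevN u Y₁ Y hY ω _ (hbound N ω hω) s s.2).trans hlt.le
        rw [← hcongr] at h1
        rw [edist_dist, Real.dist_eq]
        exact ENNReal.ofReal_le_ofReal h1
      have hmem' : ENNReal.ofReal ε ≤ ENNReal.ofReal (ε / 2) :=
        le_trans (show ENNReal.ofReal ε ≤
          edist (SkorokhodSpace.step N (v N ω) : SkorokhodSpace a 1) (Ψ (X N ω)) from hmem) hle
      have := (ENNReal.ofReal_le_ofReal_iff (half_pos hε).le).1 hmem'
      linarith
  · intro Y hY ε hε
    obtain ⟨e, he, hev⟩ := exists_smoother_sub_le hK hM hh hζ0 hNh cp ha₀.le hden'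
      -- The noise weight is `c √N = (h / N)^{1/2} / √N`, which tends to zero; hence `b = 0`.
      (β := 0) (b := 0) (c := fun N => h N ^ (1 / 2 : ℝ) * (N : ℝ) ^ (-(3 / 2) : ℝ))
      (by
        have h1 := (hratio.rpow_const (p := 1 / 2) (Or.inr (by norm_num))).mul
          tendsto_inv_sqrt_natCast
        rw [mul_zero] at h1
        refine h1.congr' ?_
        filter_upwards [eventually_ge_atTop 1] with N hN
        have hN0 : (0 : ℝ) < N := by exact_mod_cast hN
        rw [mul_assoc, rpow_neg_three_halves_mul_sqrt hN0, Real.div_rpow (hh N hN).le hN0.le,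
          ← Real.sqrt_eq_rpow (N : ℝ), div_mul_eq_mul_div, mul_div_assoc]
        congr 1
        rw [div_eq_mul_inv, ← mul_inv, Real.mul_self_sqrt hN0.le])
      (hdriftScale.congr' (by
        filter_upwards [eventually_ge_atTop 1] with N hN
        exact (rpow_scale_drift (hh N hN) (by exact_mod_cast hN)
          (show (1 / 2 : ℝ) + 0 = 1 / 2 by norm_num)).symm))
    refine tendsto_of_tendsto_of_tendsto_of_le_of_le' tendsto_const_nhds
      (SkorokhodSpace.tendsto_measure_mul_supENorm hXZ hY₁ he hε)
      (Eventually.of_forall fun _ => bot_le) ?_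
    filter_upwards [hev] with N hevN
    refine measure_mono_ae ?_
    filter_upwards [hX N] with ω hω hmem
    obtain ⟨s, hs, hεs⟩ := hmem
    have h1 := hevN u Y₁ Y hY ω _ (hbound N ω hω) s hs
    rw [zero_mul, zero_add] at h1
    exact hεs.trans h1
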